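/- Let $(W,S)$ be a right-angled Coxeter system with $S$ finite (i.e. $m(s,s')\in\{2,\infty\}$ for all $s\ne s'$ in $S$). Let $N$ be its nerve, the simplicial complex of all spherical subsets of $S$ (those $\sigma\subseteq S$, including $\emptyset$, that generate a finite subgroup $W_\sigma$), and let $\mathcal A=N\setminus\{\emptyset\}$. For $\sigma\in\mathcal A$ let $w_\sigma$ be the longest element of $W_\sigma$. The (left) greedy normal form is the language $\mathcal L\subseteq\mathcal A^*$ of all words $\sigma_n\cdots\sigma_1$ such that for each $i=1,\dots,n$ the set $\sigma_i$ is the left descent set $\{s\in S : |sw|<|w|\}$ of $w=w_{\sigma_i}w_{\sigma_{i-1}}\cdots w_{\sigma_1}$. Let $\chi=\sum_{\alpha\in\mathcal L}\alpha$ be its characteristic series. Let $\mathbb Q((\mathcal A))$ be the ring of noncommutative Laurent series, i.e. formal sums $\sum_{g} r_g\, g$ with $r_g\in\mathbb Q$, over reduced words $g$ in the free group on $\mathcal A$, such that the number of letters with exponent $-1$ in $g$ is bounded over all $g$ with $r_g\neq 0$. A representation of a power series $\lambda$ is a triple $(A,Q,B)$, where for some $n$, $A\in\mathbb Q^{1\times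 n}$, $B\in\mathbb Q^{n\times 1}$ and $Q$ is an $n\times n$ matrix whose entries are rational linear combinations of the letters, such that $\lambda=A(I-Q)^{-1}B$. Let $\bar Q$ be $Q$ with each letter $\sigma$ replaced by $\sigma^{-1}$. The reciprocal $\lambda^*$ is said to exist if $\lambda$ has a representation for which $I-\bar Q$ is invertible over $\mathbb Q((\mathcal A))$, and then $\lambda^*=A(I-\bar Q)^{-1}B$; this value is the same for all representations of $\lambda$ for which $I-\bar Q$ is invertible. For a finite simplicial complex $K$ let $\bar{\boldsymbol\chi}(K)=\sum_{\sigma\in K}(-1)^{\dim\sigma}$, the sum including the empty simplex, of dimension $-1$. For an integer $k$, $K$ is called an Eulerian sphere of dimension $k$ if $\bar{\boldsymbol\chi}(K)=(-1)^k$ and $\bar{\boldsymbol\chi}(\operatorname{Lk}(\sigma))=(-1)^{k-1-\dim\sigma}$ for every simplex $\sigma$ of $K$. If $N$ is an Eulerian sphere of dimension $k$, then $\chi$ has a reciprocal $\chi^*$, and $$\chi^*=(-1)^{k+1}\chi.$$ -/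

import Mathlib

/-! ## Noncommutative formal Laurent series -/

namespace NCLaurent

variable {α : Type*}

open Classical in
/-- The number of letters with exponent `-1` in the reduced word representing `g`. -/
noncomputable def negCount (g : FreeGroup α) : ℕ :=
  g.toWord.countP (fun p => !p.2)

theorem negCount_mul_le (g h : FreeGroup α) : negCount (g * h) ≤ negCount g + negCount h := by
  classical
  unfold negCount
  rw [← List.countP_append]
  convert (FreeGroup.toWord_mul_sublist g h).countP_le (p := fun p => !p.2)

theorem norm_eq_negCount [DecidableEq α] (g : FreeGroup α) :
    g.norm = negCount g + negCount g⁻¹ := by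
  have h1 : negCount g = g.toWord.countP (fun p => !p.2) := by unfold negCount; congr!
  have h2 : negCount g⁻¹ = g.toWord.countP (fun p => p.2) := by
    have : negCount g⁻¹ = g⁻¹.toWord.countP (fun p => !p.2) := by unfold negCount; congr!
    rw [this, FreeGroup.toWord_inv, FreeGroup.invRev, List.countP_reverse, List.countP_map]
    congr 1
    funext p
    simp
  rw [h1, h2, FreeGroup.norm, add_comm]
  simpa using List.length_eq_countP_add_countP (fun p : α × Bool => p.2) (l := g.toWord)

/-- Only finitely many factorizations `g = b * c` have boundedly many inverse letters in `b`, `c`. -/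
theorem finite_factorizations [Finite α] (n m : ℕ) (g : FreeGroup α) :
    {b : FreeGroup α | negCount b ≤ n ∧ negCount (b⁻¹ * g) ≤ m}.Finite := by
  classical
  have hf : {b : FreeGroup α | b.toWord.length ≤ n + (m + negCount g⁻¹)}.Finite :=
    (List.finite_length_le (α × Bool) _).preimage FreeGroup.toWord_injective.injOn
  refine hf.subset ?_
  rintro b ⟨h1, h2⟩
  have h3 := norm_eq_negCount b
  have h4 := negCount_mul_le (b⁻¹ * g) g⁻¹
  rw [mul_inv_cancel_right] at h4
  change b.norm ≤ _
  omega

variable (α) in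
/-- The families of rational coefficients, indexed by the free group on `α` (the reduced words in
the letters and their inverses), for which the number of inverse letters is bounded on the
support. -/
def boundedFamilies : Submodule ℚ (FreeGroup α → ℚ) where
  carrier := {f | ∃ n : ℕ, ∀ g, f g ≠ 0 → negCount g ≤ n}
  zero_mem' := ⟨0, fun g hg => absurd rfl hg⟩
  add_mem' := by
    rintro f f' ⟨n, hn⟩ ⟨n', hn'⟩
    refine ⟨max n n', fun g hg => ?_⟩
    by_cases h : f g = 0
    · have h' : f' g ≠ 0 := by
        intro h'
        exact hg (by simp [h, h'])
      exact (hn' g h').trans (le_max_right _ _)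
    · exact (hn g h).trans (le_max_left _ _)
  smul_mem' := by
    rintro c f ⟨n, hn⟩
    refine ⟨n, fun g hg => hn g ?_⟩
    rintro h
    exact hg (by simp [h])

end NCLaurent

/-- Formal Laurent series over `ℚ` in the noncommuting letters of the alphabet `α`. -/
def NCLaurent (α : Type*) : Type _ := NCLaurent.boundedFamilies α

namespace NCLaurent

variable {α : Type*}

instance instAddCommGroup : AddCommGroup (NCLaurent α) :=
  inferInstanceAs (AddCommGroup (boundedFamilies α))

instance instModule : Module ℚ (NCLaurent α) :=
  inferInstanceAs (Module ℚ (boundedFamilies α))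

/-- The coefficient of the group element `g` in a Laurent series. -/
def coeff (x : NCLaurent α) (g : FreeGroup α) : ℚ := x.1 g

theorem exists_bound (x : NCLaurent α) : ∃ n : ℕ, ∀ g, x.coeff g ≠ 0 → negCount g ≤ n := x.2

@[ext]
theorem ext {x y : NCLaurent α} (h : ∀ g, x.coeff g = y.coeff g) : x = y :=
  Subtype.ext (funext h)

@[simp]
theorem coeff_zero (g : FreeGroup α) : (0 : NCLaurent α).coeff g = 0 := rfl

@[simp]
theorem coeff_add (x y : NCLaurent α) (g : FreeGroup α) :
    (x + y).coeff g = x.coeff g + y.coeff g := rfl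

@[simp]
theorem coeff_smul (c : ℚ) (x : NCLaurent α) (g : FreeGroup α) :
    (c • x).coeff g = c * x.coeff g := rfl

theorem factor_ne_zero {x y : NCLaurent α} {g : FreeGroup α}
    (h : ∑ᶠ b, x.coeff b * y.coeff (b⁻¹ * g) ≠ 0) :
    ∃ b, x.coeff b ≠ 0 ∧ y.coeff (b⁻¹ * g) ≠ 0 := by
  by_contra! hc
  refine h (finsum_eq_zero_of_forall_eq_zero fun b => ?_)
  by_cases hb : x.coeff b = 0
  · simp [hb]
  · simp [hc b hb]

/-- The coefficient of `g` in `x * y` is the sum of `x.coeff b * y.coeff c` over all pairs with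
`b * c = g`, that is, `c = b⁻¹ * g`. For a finite alphabet this sum has finitely many nonzero
terms (see `finite_support_mul`). -/
noncomputable instance : Mul (NCLaurent α) where
  mul x y := ⟨fun g => ∑ᶠ b, x.coeff b * y.coeff (b⁻¹ * g), by
    obtain ⟨n, hn⟩ := x.exists_bound
    obtain ⟨m, hm⟩ := y.exists_bound
    refine ⟨n + m, fun g hg => ?_⟩
    obtain ⟨b, hb, hb2⟩ := factor_ne_zero hg
    have h := negCount_mul_le b (b⁻¹ * g)
    rw [mul_inv_cancel_left] at h
    have h1 := hn b hb
    have h2 := hm _ hb2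
    omega⟩

theorem coeff_mul (x y : NCLaurent α) (g : FreeGroup α) :
    (x * y).coeff g = ∑ᶠ b, x.coeff b * y.coeff (b⁻¹ * g) := rfl

open Classical in
/-- A Laurent polynomial, i.e. an element of the group algebra of the free group, regarded as a
Laurent series. -/
noncomputable def ofPoly (p : MonoidAlgebra ℚ (FreeGroup α)) : NCLaurent α :=
  ⟨fun g => p.coeff g, by
    refine ⟨p.coeff.support.sup negCount, fun g hg => ?_⟩
    exact Finset.le_sup (f := negCount) (Finsupp.mem_support_iff.mpr hg)⟩

noncomputable instance : One (NCLaurent α) := ⟨ofPoly 1⟩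

open Classical in
theorem coeff_one (g : FreeGroup α) : (1 : NCLaurent α).coeff g = if g = 1 then 1 else 0 := by
  change (MonoidAlgebra.coeff (1 : MonoidAlgebra ℚ (FreeGroup α))) g = _
  rw [MonoidAlgebra.one_def]
  simp [Finsupp.single_apply, eq_comm]

theorem finite_support_mul [Finite α] (x y : NCLaurent α) (g : FreeGroup α) :
    (Function.support fun b => x.coeff b * y.coeff (b⁻¹ * g)).Finite := by
  obtain ⟨n, hn⟩ := x.exists_bound
  obtain ⟨m, hm⟩ := y.exists_bound
  refine (finite_factorizations n m g).subset fun b hb => ?_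
  exact ⟨hn b (left_ne_zero_of_mul hb), hm _ (right_ne_zero_of_mul hb)⟩

theorem mul_assoc_aux [Finite α] (x y z : NCLaurent α) : x * y * z = x * (y * z) := by
  classical
  ext g
  obtain ⟨n, hn⟩ := x.exists_bound
  obtain ⟨m, hm⟩ := y.exists_bound
  obtain ⟨l, hl⟩ := z.exists_bound
  let T : FreeGroup α → FreeGroup α → ℚ := fun b c =>
    x.coeff b * y.coeff (b⁻¹ * c) * z.coeff (c⁻¹ * g)
  let s : Finset (FreeGroup α) := (finite_factorizations n (m + l) g).toFinset
  let t : Finset (FreeGroup α) := (finite_factorizations (n + m) l g).toFinset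
  have hT : ∀ b c, T b c ≠ 0 → b ∈ s ∧ c ∈ t := by
    intro b c h
    have h1 := hn b (left_ne_zero_of_mul (left_ne_zero_of_mul h))
    have h2 := hm _ (right_ne_zero_of_mul (left_ne_zero_of_mul h))
    have h3 := hl _ (right_ne_zero_of_mul h)
    have h4 := negCount_mul_le (b⁻¹ * c) (c⁻¹ * g)
    have h5 := negCount_mul_le b (b⁻¹ * c)
    rw [show b⁻¹ * c * (c⁻¹ * g) = b⁻¹ * g by group] at h4
    rw [show b * (b⁻¹ * c) = c by group] at h5
    constructor
    · simp only [s, Set.Finite.mem_toFinset, Set.mem_ofPred_eq]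
      omega
    · simp only [t, Set.Finite.mem_toFinset, Set.mem_ofPred_eq]
      omega
  have hL : (x * y * z).coeff g = ∑ᶠ c, ∑ᶠ b, T b c := by
    rw [coeff_mul]
    refine finsum_congr fun c => ?_
    rw [coeff_mul, finsum_mul]
  have hR : (x * (y * z)).coeff g = ∑ᶠ b, ∑ᶠ c, T b c := by
    rw [coeff_mul]
    refine finsum_congr fun b => ?_
    rw [coeff_mul, mul_finsum, ← finsum_comp_equiv (Equiv.mulLeft b⁻¹)]
    refine finsum_congr fun c => ?_
    simp only [T, Equiv.coe_mulLeft]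
    rw [show (b⁻¹ * c)⁻¹ * (b⁻¹ * g) = c⁻¹ * g by group]
    ring
  have e1 : ∀ c, ∑ᶠ b, T b c = ∑ b ∈ s, T b c := fun c =>
    finsum_eq_sum_of_support_subset _ fun b hb => (hT b c hb).1
  have e2 : ∀ b, ∑ᶠ c, T b c = ∑ c ∈ t, T b c := fun b =>
    finsum_eq_sum_of_support_subset _ fun c hc => (hT b c hc).2
  rw [hL, hR]
  simp only [e1, e2]
  rw [finsum_eq_sum_of_support_subset (s := t), finsum_eq_sum_of_support_subset (s := s),
    Finset.sum_comm]
  · intro b hb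
    obtain ⟨c, -, hc⟩ := Finset.exists_ne_zero_of_sum_ne_zero hb
    exact (hT b c hc).1
  · intro c hc
    obtain ⟨b, -, hb⟩ := Finset.exists_ne_zero_of_sum_ne_zero hc
    exact (hT b c hb).2

/-- The ring of noncommutative Laurent series over a finite alphabet. -/
noncomputable instance instRing [Finite α] : Ring (NCLaurent α) where
  __ := instAddCommGroup
  mul_assoc := mul_assoc_aux
  one_mul x := by
    classical
    ext g
    rw [coeff_mul, finsum_eq_single _ 1]
    · simp [coeff_one]
    · intro b hb
      simp [coeff_one, hb]
  mul_one x := by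
    classical
    ext g
    rw [coeff_mul, finsum_eq_single _ g]
    · simp [coeff_one]
    · intro b hb
      have : ¬ (b⁻¹ * g = 1) := fun h => hb (inv_mul_eq_one.mp h)
      simp [coeff_one, this]
  zero_mul x := by
    ext g
    simp [coeff_mul]
  mul_zero x := by
    ext g
    simp [coeff_mul]
  left_distrib x y z := by
    ext g
    simp only [coeff_mul, coeff_add, mul_add]
    exact finsum_add_distrib (finite_support_mul x y g) (finite_support_mul x z g)
  right_distrib x y z := by
    ext g
    simp only [coeff_mul, coeff_add, add_mul]
    exact finsum_add_distrib (finite_support_mul x z g) (finite_support_mul y z g)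

/-- A word in the letters (a list, read from left to right) as an element of the free group. -/
def word (u : List α) : FreeGroup α := (u.map FreeGroup.of).prod

open Classical in
/-- The characteristic series of a language: the sum of all its words. -/
noncomputable def charSeries (L : Language α) : NCLaurent α :=
  ⟨fun g => if ∃ u ∈ L, word u = g then 1 else 0, by
    refine ⟨0, fun g hg => ?_⟩
    obtain ⟨u, -, rfl⟩ : ∃ u ∈ L, word u = g := by
      by_contra h
      exact hg (by simp only [if_neg h])
    clear hg
    induction u with
    | nil => simp [word, negCount]
    | cons a u ih =>
      have h := negCount_mul_le (FreeGroup.of a) (word u)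
      have h0 : negCount (FreeGroup.of a) = 0 := by simp [negCount]
      have h1 : word (a :: u) = FreeGroup.of a * word u := by simp [word]
      rw [h1]
      omega⟩

/-- The involution on Laurent polynomials that replaces every letter by its inverse and every
inverse letter by the letter. -/
noncomputable def bar : MonoidAlgebra ℚ (FreeGroup α) → MonoidAlgebra ℚ (FreeGroup α) :=
  MonoidAlgebra.mapDomain (FreeGroup.lift fun a => (FreeGroup.of a)⁻¹)

/-- `p` is a linear homogeneous polynomial: a rational linear combination of the letters. -/
def IsLinearHomogeneous (p : MonoidAlgebra ℚ (FreeGroup α)) : Prop :=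
  ∀ g, p.coeff g ≠ 0 → ∃ a : α, g = FreeGroup.of a

/-- `S` is a two-sided inverse of the square matrix `T`. -/
def IsInverse [Finite α] {n : ℕ} (T S : Matrix (Fin n) (Fin n) (NCLaurent α)) : Prop :=
  T * S = 1 ∧ S * T = 1

/-- The series `A R C`, for a rational row vector `A` and a rational column vector `C`. -/
noncomputable def sandwich {n : ℕ} (A : Fin n → ℚ) (R : Matrix (Fin n) (Fin n) (NCLaurent α))
    (C : Fin n → ℚ) : NCLaurent α :=
  ∑ i, ∑ j, (A i * C j) • R i j

/-- `(A, Q, C)` is a representation of the series `x`: the entries of `Q` are linear homogeneous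
and `x = A (I - Q)⁻¹ C`. -/
def IsRepresentation [Finite α] (x : NCLaurent α) {n : ℕ} (A : Fin n → ℚ)
    (Q : Matrix (Fin n) (Fin n) (MonoidAlgebra ℚ (FreeGroup α))) (C : Fin n → ℚ) : Prop :=
  (∀ i j, IsLinearHomogeneous (Q i j)) ∧
    ∃ R, IsInverse (1 - Q.map ofPoly) R ∧ x = sandwich A R C

/-- The reciprocal of `x` exists and is equal to `y`: some representation `(A, Q, C)` of `x` has
`I - Q̄` invertible over the ring of Laurent series, where `Q̄` is `Q` with all letters inverted, and
`A (I - Q̄)⁻¹ C = y` for every representation of `x` such that `I - Q̄` is invertible. -/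
def IsReciprocal [Finite α] (x y : NCLaurent α) : Prop :=
  (∃ (n : ℕ) (A : Fin n → ℚ) (Q : Matrix (Fin n) (Fin n) (MonoidAlgebra ℚ (FreeGroup α)))
    (C : Fin n → ℚ), IsRepresentation x A Q C ∧
      ∃ R, IsInverse (1 - (Q.map bar).map ofPoly) R) ∧
  ∀ (n : ℕ) (A : Fin n → ℚ) (Q : Matrix (Fin n) (Fin n) (MonoidAlgebra ℚ (FreeGroup α)))
    (C : Fin n → ℚ), IsRepresentation x A Q C →
      ∀ R, IsInverse (1 - (Q.map bar).map ofPoly) R → sandwich A R C = y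

end NCLaurent

/-! ## Eulerian spheres -/

namespace PreAbstractSimplicialComplex

variable {V : Type*}

open Classical in
/-- The link of `σ` in `K` (nonempty faces only): the faces disjoint from `σ` that span a face of
`K` together with `σ`. -/
def link (K : PreAbstractSimplicialComplex V) (σ : Finset V) : PreAbstractSimplicialComplex V where
  faces := {τ | τ.Nonempty ∧ Disjoint τ σ ∧ τ ∪ σ ∈ K.faces}
  isRelLowerSet_faces := by
    rintro τ ⟨h1, h2, h3⟩
    refine ⟨h1, fun ρ hρ hne => ⟨hne, h2.mono_left hρ, ?_⟩⟩
    exact (K.isRelLowerSet_faces h3).2 (Finset.union_subset_union_left hρ)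
      (hne.mono Finset.subset_union_left)

open Classical in
/-- The reduced Euler characteristic of a finite complex: the sum of `(-1) ^ dim σ` over all
simplices `σ`, where `dim σ = card σ - 1`. The empty simplex, which is not listed among `K.faces`,
has dimension `-1` and contributes the summand `-1`. -/
noncomputable def reducedEulerChar [Fintype V] (K : PreAbstractSimplicialComplex V) : ℤ :=
  -1 + ∑ σ : Finset V with σ ∈ K.faces, (-1) ^ (σ.card - 1)

/-- `K` is an Eulerian sphere of dimension `k`. -/
def IsEulerianSphere [Fintype V] (K : PreAbstractSimplicialComplex V) (k : ℤ) : Prop :=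
  K.reducedEulerChar = k.negOnePow ∧
    ∀ σ ∈ K.faces, (K.link σ).reducedEulerChar = (k - 1 - ((σ.card : ℤ) - 1)).negOnePow

end PreAbstractSimplicialComplex

/-! ## Coxeter groups and the greedy normal form -/

/-- The Coxeter matrix is right-angled: all off-diagonal entries are `2` or infinity (which is
encoded by the entry `0`). -/
def CoxeterMatrix.IsRightAngled {B : Type*} (M : CoxeterMatrix B) : Prop :=
  ∀ i j, i ≠ j → M i j = 2 ∨ M i j = 0

namespace CoxeterSystem

variable {B : Type*} {M : CoxeterMatrix B} {W : Type*} [Group W] (cs : CoxeterSystem M W)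

/-- The parabolic subgroup generated by a set of simple reflections. -/
def parabolic (σ : Finset B) : Subgroup W := Subgroup.closure (cs.simple '' (σ : Set B))

/-- The nerve: the simplicial complex on the set of simple reflections whose (nonempty) faces are
the nonempty spherical subsets, i.e. those which generate a finite subgroup. -/
def nerve : AbstractSimplicialComplex B where
  faces := {σ | σ.Nonempty ∧ Finite (cs.parabolic σ)}
  isRelLowerSet_faces := by
    rintro σ ⟨h1, h2⟩
    refine ⟨h1, fun τ hτ hne => ⟨hne, ?_⟩⟩
    have hle : cs.parabolic τ ≤ cs.parabolic σ :=
      Subgroup.closure_mono (Set.image_mono (by exact_mod_cast hτ))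
    exact Finite.of_injective _ (Subgroup.inclusion_injective hle)
  singleton_mem := by
    intro i
    refine ⟨Finset.singleton_nonempty i, ?_⟩
    have h : cs.parabolic {i} = Subgroup.zpowers (cs.simple i) := by
      simp [parabolic, Subgroup.zpowers_eq_closure]
    rw [h]
    have hfin : IsOfFinOrder (cs.simple i) :=
      isOfFinOrder_iff_pow_eq_one.mpr ⟨2, by norm_num, cs.simple_sq i⟩
    exact hfin.finite_zpowers

/-- The proper nerve, the alphabet of the greedy normal form: all nonempty spherical subsets. -/
abbrev ProperNerve : Type _ := {σ : Finset B // σ ∈ cs.nerve.faces}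

theorem exists_longest (σ : cs.ProperNerve) :
    ∃ w ∈ cs.parabolic σ.1, ∀ v ∈ cs.parabolic σ.1, cs.length v ≤ cs.length w := by
  have hf : (cs.parabolic σ.1 : Set W).Finite := σ.2.2
  exact Set.exists_max_image _ cs.length hf ⟨1, one_mem _⟩

/-- The element of longest length in the finite parabolic subgroup generated by `σ`. (It is unique,
by the standard theory of finite Coxeter groups.) -/
noncomputable def longest (σ : cs.ProperNerve) : W := (cs.exists_longest σ).choose

/-- The element of `W` represented by a word over the proper nerve. -/
noncomputable def eval (u : List cs.ProperNerve) : W := (u.map cs.longest).prod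

/-- A word `σₙ ⋯ σ₁` (read from left to right) is greedy if each `σᵢ` is the left descent set of
the group element represented by `σᵢ ⋯ σ₁`. -/
def IsGreedy : List cs.ProperNerve → Prop
  | [] => True
  | σ :: u => (∀ i : B, i ∈ σ.1 ↔ cs.IsLeftDescent (cs.eval (σ :: u)) i) ∧ IsGreedy u

/-- The left greedy normal form. -/
def greedyNormalForm : Language cs.ProperNerve := {u | cs.IsGreedy u}

end CoxeterSystem

/-!
Greediness is a local condition: a word in the simplices of the nerve `N` is greedy if and only if,
for every pair of adjacent letters `σ ρ`, the simplex `ρ` contains no vertex of the star of `σ`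
(`CoxeterSystem.isGreedy_cons_iff`). This rests on two facts about right-angled Coxeter groups: left
multiplication by `s` does not affect the descents commuting with `s` and different from it, and the
descents of an element commute pairwise. Both are read off from the coordinates of a generic point
of a chamber, whose signs are the descents (`CoxeterSystem.chamberPoint_spec`).

Let `E` be the `0`-`1` matrix of this condition, indexed by all simplices including `∅`, let `D` be
the diagonal matrix with the entry `σ` at each nonempty simplex `σ` and `0` at `∅`, and let
`Q = D E` and `G = (1 - Q)⁻¹`. Then `χ` is the sum of the entries of the column of `G` at `∅`. Let
`S` be the diagonal matrix of the signs `(-1) ^ card σ` and `Z` the incidence matrix of the face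
relation. If `N` is an Eulerian sphere of dimension `k` and `ε = (-1) ^ (k + 1)`, then
`E = ε Z S Zᵀ S Z` (`CoxeterMatrix.greedyMatrix_eq`), and Möbius inversion `Z S Z S = 1` gives
`E⁻¹ = S E S` and `1ᵀ S E = ε 1ᵀ`. If `P` is the diagonal matrix with the entries `σ`, and `-1` at
`∅`, then `P (1 - Q̄) = D - E = - S (1 - Q) S E`. Hence `1 - Q̄` is invertible with the inverse
`- S E G S P`, whose column at `∅` is that of `S E G`, and its entries add up to `ε χ`.

The value of a reciprocal is independent of the representation
(`NCLaurent.sandwich_eq_sandwich`): the difference of two representations represents zero, so it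
suffices that a representation `(A, Q, C)` of zero has reciprocal zero. A permutation representation
`π` of the free group on a finite set sends Laurent series to matrices over the field of commutative
Laurent series, by `g ↦ π g * t ^ degree g`, and these images determine a Laurent series since free
groups are residually finite. Over the field the statement is linear algebra: the image of `1 - Q̄`
preserves the space of vectors annihilated by all `A μ(u)`, where `μ(u)` is the coefficient of `Q^n`
at the word `u` of length `n`, and so does its inverse by finiteness of the dimension.
-/

/-! ### Laurent series and matrices of letters -/

namespace NCLaurent

variable {α : Type*}

theorem coeff_ofPoly (p : MonoidAlgebra ℚ (FreeGroup α)) (g : FreeGroup α) :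
    (ofPoly p).coeff g = p.coeff g := rfl

/-- The group element `h`, regarded as a Laurent series. -/
noncomputable def mono (h : FreeGroup α) : NCLaurent α := ofPoly (MonoidAlgebra.single h 1)

open Classical in
theorem coeff_mono (h g : FreeGroup α) : (mono h).coeff g = if h = g then 1 else 0 := by
  rw [mono, coeff_ofPoly, MonoidAlgebra.coeff_single, Finsupp.single_apply]

theorem coeff_mono_mul (h : FreeGroup α) (y : NCLaurent α) (g : FreeGroup α) :
    (mono h * y).coeff g = y.coeff (h⁻¹ * g) := by
  classical
  rw [coeff_mul, finsum_eq_single _ h]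
  · simp [coeff_mono]
  · intro b hb
    simp [coeff_mono, hb.symm]

theorem mono_one : (mono 1 : NCLaurent α) = 1 := rfl

theorem mono_mul_mono (h k : FreeGroup α) : mono h * mono k = mono (h * k) := by
  classical
  ext g
  rw [coeff_mono_mul]
  simp [coeff_mono, eq_inv_mul_iff_mul_eq]

/-- Taking the coefficient at `g`, as a linear map. -/
def lcoeff (g : FreeGroup α) : NCLaurent α →ₗ[ℚ] ℚ where
  toFun x := x.coeff g
  map_add' _ _ := rfl
  map_smul' _ _ := rfl

theorem coeff_sum {β : Type*} (s : Finset β) (x : β → NCLaurent α) (g : FreeGroup α) :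
    (∑ b ∈ s, x b).coeff g = ∑ b ∈ s, (x b).coeff g :=
  map_sum (lcoeff g) x s

theorem smul_mul (c : ℚ) (x y : NCLaurent α) : c • x * y = c • (x * y) := by
  ext g
  simp only [coeff_mul, coeff_smul, mul_finsum, mul_assoc]

theorem mul_smul_eq (c : ℚ) (x y : NCLaurent α) : x * c • y = c • (x * y) := by
  ext g
  simp only [coeff_mul, coeff_smul, mul_finsum]
  exact finsum_congr fun b => by ring

noncomputable instance instAlgebra [Finite α] : Algebra ℚ (NCLaurent α) :=
  Algebra.ofModule smul_mul fun c x y => mul_smul_eq c x y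

/-- The exponent sum of an element of the free group. -/
def degree (g : FreeGroup α) : ℤ :=
  (FreeGroup.lift (fun _ : α => Multiplicative.ofAdd (1 : ℤ)) g).toAdd

@[simp] theorem degree_one : degree (1 : FreeGroup α) = 0 := by simp [degree]

@[simp] theorem degree_mul (g h : FreeGroup α) : degree (g * h) = degree g + degree h := by
  simp [degree]

@[simp] theorem degree_inv (g : FreeGroup α) : degree g⁻¹ = -degree g := by simp [degree]

@[simp] theorem degree_of (a : α) : degree (FreeGroup.of a) = 1 := by simp [degree]

theorem degree_eq [DecidableEq α] (g : FreeGroup α) :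
    degree g = (g.norm : ℤ) - 2 * (negCount g : ℤ) := by
  have key : ∀ L : List (α × Bool),
      degree (FreeGroup.mk L) = (L.length : ℤ) - 2 * (L.countP (fun p => !p.2) : ℤ) := by
    intro L
    induction L with
    | nil => exact degree_one
    | cons p L ih =>
      obtain ⟨a, b⟩ := p
      have h : FreeGroup.mk ((a, b) :: L) = FreeGroup.mk [(a, b)] * FreeGroup.mk L := by
        rw [FreeGroup.mul_mk]; rfl
      rw [h, degree_mul, ih]
      cases b
      · have h1 : FreeGroup.mk [(a, false)] = (FreeGroup.of a)⁻¹ := rfl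
        rw [h1]
        simp
        ring
      · have h1 : FreeGroup.mk [(a, true)] = FreeGroup.of a := rfl
        rw [h1]
        simp
        ring
  have h1 : negCount g = g.toWord.countP (fun p => !p.2) := by unfold negCount; congr!
  rw [h1, FreeGroup.norm, ← key, FreeGroup.mk_toWord]

theorem neg_negCount_le_degree (g : FreeGroup α) : -(negCount g : ℤ) ≤ degree g := by
  classical
  have h1 := degree_eq g
  have h2 := norm_eq_negCount g
  omega

/-- A Laurent series has only finitely many terms of a given degree. -/
theorem finite_support_degree [Finite α] (x : NCLaurent α) (m : ℤ) :
    {g | degree g = m ∧ x.coeff g ≠ 0}.Finite := by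
  classical
  obtain ⟨n, hn⟩ := x.exists_bound
  have hf : {g : FreeGroup α | g.toWord.length ≤ (m + 2 * n).toNat}.Finite :=
    (List.finite_length_le (α × Bool) _).preimage FreeGroup.toWord_injective.injOn
  refine hf.subset ?_
  rintro g ⟨hg, hx⟩
  have h1 := degree_eq g
  have h2 := hn g hx
  change g.norm ≤ _
  omega

variable {ι κ : Type*}

/-- The matrix `∑ a, μ a * f a` of Laurent polynomials, for rational matrices `μ a` and group
elements `f a`. -/
noncomputable def letterMatrix [Fintype α] (f : α → FreeGroup α) (μ : α → Matrix ι ι ℚ) :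
    Matrix ι ι (NCLaurent α) :=
  fun i j => ∑ a, μ a i j • mono (f a)

section LinearForms

variable [Fintype α] {p : MonoidAlgebra ℚ (FreeGroup α)}

theorem IsLinearHomogeneous.eq_sum (hp : IsLinearHomogeneous p) :
    p = ∑ a, MonoidAlgebra.single (FreeGroup.of a) (p.coeff (FreeGroup.of a)) := by
  classical
  ext g
  rw [MonoidAlgebra.coeff_sum, Finsupp.finsetSum_apply]
  simp only [MonoidAlgebra.coeff_single, Finsupp.single_apply]
  by_cases hg : ∃ a : α, g = FreeGroup.of a
  · obtain ⟨a, rfl⟩ := hg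
    rw [Finset.sum_eq_single a]
    · simp
    · intro b _ hb
      rw [if_neg fun h => hb (FreeGroup.of_injective h)]
    · simp
  · rw [Finset.sum_eq_zero]
    · by_contra h
      exact hg (hp g h)
    · intro a _
      rw [if_neg fun h => hg ⟨a, h.symm⟩]

theorem ofPoly_sum_single {β : Type*} [Fintype β] (f : β → FreeGroup α) (c : β → ℚ) :
    ofPoly (∑ a, MonoidAlgebra.single (f a) (c a)) = ∑ a, c a • mono (f a) := by
  classical
  ext g
  rw [coeff_ofPoly, MonoidAlgebra.coeff_sum, Finsupp.finsetSum_apply, coeff_sum]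
  simp [Finsupp.single_apply, coeff_mono]

theorem IsLinearHomogeneous.ofPoly_eq (hp : IsLinearHomogeneous p) :
    ofPoly p = ∑ a, p.coeff (FreeGroup.of a) • mono (FreeGroup.of a) := by
  conv_lhs => rw [hp.eq_sum]
  exact ofPoly_sum_single _ _

theorem IsLinearHomogeneous.ofPoly_bar_eq (hp : IsLinearHomogeneous p) :
    ofPoly (bar p) = ∑ a, p.coeff (FreeGroup.of a) • mono (FreeGroup.of a)⁻¹ := by
  have h : bar p =
      ∑ a, MonoidAlgebra.single (FreeGroup.of a)⁻¹ (p.coeff (FreeGroup.of a)) := by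
    conv_lhs => rw [hp.eq_sum]
    change MonoidAlgebra.mapDomainLinearMap ℚ ℚ _ _ = _
    rw [map_sum]
    refine Finset.sum_congr rfl fun a _ => ?_
    rw [MonoidAlgebra.mapDomainLinearMap_single, FreeGroup.lift_apply_of]
  rw [h, ofPoly_sum_single]

end LinearForms

theorem coeff_letterMatrix_mul [Fintype α] [Fintype ι] (f : α → FreeGroup α)
    (μ : α → Matrix ι ι ℚ) (R : Matrix ι κ (NCLaurent α)) (i : ι) (j : κ) (g : FreeGroup α) :
    ((letterMatrix f μ * R) i j).coeff g =
      ∑ a, ∑ l, μ a i l * (R l j).coeff ((f a)⁻¹ * g) := by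
  rw [Matrix.mul_apply, coeff_sum, Finset.sum_comm]
  refine Finset.sum_congr rfl fun l _ => ?_
  rw [letterMatrix, Finset.sum_mul, coeff_sum]
  refine Finset.sum_congr rfl fun a _ => ?_
  rw [smul_mul, coeff_smul, coeff_mono_mul]

/-! ### The geometric series of a matrix of letters -/

/-- A matrix fixed by multiplication by a linear homogeneous matrix vanishes: the multiplication
raises degrees, while the degrees of the terms of a Laurent series are bounded below. -/
theorem eq_zero_of_letterMatrix_mul_eq [Fintype α] [Fintype ι] [Finite κ] {μ : α → Matrix ι ι ℚ}
    {X : Matrix ι κ (NCLaurent α)} (h : letterMatrix FreeGroup.of μ * X = X) : X = 0 := by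
  have hb : ∃ n : ℕ, ∀ i j g, (X i j).coeff g ≠ 0 → negCount g ≤ n := by
    choose n hn using fun i j => (X i j).exists_bound
    obtain ⟨N, hN⟩ := (Set.finite_range fun p : ι × κ => n p.1 p.2).bddAbove
    exact ⟨N, fun i j g hg => (hn i j g hg).trans (hN ⟨(i, j), rfl⟩)⟩
  obtain ⟨n, hn⟩ := hb
  have key : ∀ (m : ℕ) i j g, degree g < m - n → (X i j).coeff g = 0 := by
    intro m
    induction m with
    | zero =>
      intro i j g hg
      by_contra hne
      have h1 := hn i j g hne
      have h2 := neg_negCount_le_degree g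
      push_cast at hg
      omega
    | succ m ih =>
      intro i j g hg
      rw [← h, coeff_letterMatrix_mul]
      refine Finset.sum_eq_zero fun a _ => Finset.sum_eq_zero fun l _ => ?_
      rw [ih l j _ (by simp; push_cast at hg; omega), mul_zero]
  ext i j g
  exact key (degree g + n + 1).toNat i j g (by omega)

theorem word_cons (a : α) (u : List α) : word (a :: u) = FreeGroup.of a * word u := by
  simp [word]

theorem word_nil : word ([] : List α) = 1 := by simp [word]

theorem word_injective : Function.Injective (word : List α → FreeGroup α) := by
  have h : ∀ u : List α, word u = FreeGroup.mk (u.map fun a => (a, true)) := by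
    intro u
    induction u with
    | nil => rfl
    | cons a u ih =>
      rw [word_cons, ih, List.map_cons, FreeGroup.of, FreeGroup.mul_mk]
      rfl
  classical
  intro u v huv
  rw [h, h] at huv
  have hr : ∀ u : List α, FreeGroup.IsReduced (u.map fun a => (a, true)) := by
    intro u
    rw [FreeGroup.IsReduced, List.isChain_map]
    exact (List.pairwise_of_forall fun _ _ _ => rfl).isChain
  have := congrArg FreeGroup.toWord huv
  rw [FreeGroup.toWord_mk, FreeGroup.toWord_mk, (hr u).reduce_eq, (hr v).reduce_eq] at this
  exact List.map_injective_iff.mpr (fun a b hab => (Prod.ext_iff.mp hab).1) this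

theorem negCount_word (u : List α) : negCount (word u) = 0 := by
  induction u with
  | nil => simp [word, negCount]
  | cons a u ih =>
    have h := negCount_mul_le (FreeGroup.of a) (word u)
    have h0 : negCount (FreeGroup.of a) = 0 := by simp [negCount]
    rw [word_cons]
    omega

open Classical in
/-- The power series with the coefficient `c u` at every word `u`. -/
noncomputable def ofWords (c : List α → ℚ) : NCLaurent α :=
  ⟨fun g => if h : ∃ u, word u = g then c h.choose else 0, by
    refine ⟨0, fun g hg => ?_⟩
    obtain ⟨u, rfl⟩ : ∃ u, word u = g := by
      by_contra h
      exact hg (dif_neg h)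
    exact (negCount_word u).le⟩

theorem coeff_ofWords (c : List α → ℚ) (u : List α) : (ofWords c).coeff (word u) = c u := by
  have h : ∃ v, word v = word u := ⟨u, rfl⟩
  have e : (ofWords c).coeff (word u) = c h.choose := dif_pos h
  rw [e, word_injective h.choose_spec]

theorem coeff_ofWords_of_forall_ne (c : List α → ℚ) {g : FreeGroup α} (hg : ∀ u, word u ≠ g) :
    (ofWords c).coeff g = 0 :=
  dif_neg fun ⟨u, hu⟩ => hg u hu

open Classical in
theorem charSeries_eq (L : Language α) :
    charSeries L = ofWords fun u => if u ∈ L then 1 else 0 := by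
  ext g
  by_cases hg : ∃ u, word u = g
  · obtain ⟨u, rfl⟩ := hg
    rw [coeff_ofWords]
    change (if ∃ v ∈ L, word v = word u then (1 : ℚ) else 0) = _
    refine if_congr ⟨?_, fun h => ⟨u, h, rfl⟩⟩ rfl rfl
    rintro ⟨v, hv, hvu⟩
    rwa [← word_injective hvu]
  · push Not at hg
    rw [coeff_ofWords_of_forall_ne _ hg]
    exact if_neg fun ⟨v, _, hv⟩ => hg v hv

section GeomSeries

variable [Fintype ι] [DecidableEq ι]

/-- The product of the coefficient matrices along a word. -/
def wordMatrix (μ : α → Matrix ι ι ℚ) (u : List α) : Matrix ι ι ℚ := (u.map μ).prod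

@[simp] theorem wordMatrix_nil (μ : α → Matrix ι ι ℚ) : wordMatrix μ [] = 1 := rfl

@[simp] theorem wordMatrix_cons (μ : α → Matrix ι ι ℚ) (a : α) (u : List α) :
    wordMatrix μ (a :: u) = μ a * wordMatrix μ u := by
  simp [wordMatrix]

/-- The geometric series `∑ n, Q ^ n` of the linear homogeneous matrix `Q = ∑ a, μ a * a`. -/
noncomputable def geomSeries (μ : α → Matrix ι ι ℚ) : Matrix ι ι (NCLaurent α) :=
  fun i j => ofWords fun u => wordMatrix μ u i j

theorem coeff_geomSeries (μ : α → Matrix ι ι ℚ) (i j : ι) (u : List α) :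
    (geomSeries μ i j).coeff (word u) = wordMatrix μ u i j :=
  coeff_ofWords _ _

theorem coeff_geomSeries_of_forall_ne (μ : α → Matrix ι ι ℚ) (i j : ι) {g : FreeGroup α}
    (hg : ∀ u, word u ≠ g) : (geomSeries μ i j).coeff g = 0 :=
  coeff_ofWords_of_forall_ne _ hg

variable [Fintype α] (μ : α → Matrix ι ι ℚ)

theorem geomSeries_eq : geomSeries μ = 1 + letterMatrix FreeGroup.of μ * geomSeries μ := by
  classical
  ext i j g
  rw [Matrix.add_apply, coeff_add, coeff_letterMatrix_mul]
  by_cases hg : ∃ u, word u = g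
  · obtain ⟨u, rfl⟩ := hg
    rw [coeff_geomSeries]
    cases u with
    | nil =>
      rw [Finset.sum_eq_zero, wordMatrix_nil, word_nil, Matrix.one_apply, Matrix.one_apply]
      · split_ifs <;> simp [coeff_one]
      · intro a _
        refine Finset.sum_eq_zero fun l _ => ?_
        rw [coeff_geomSeries_of_forall_ne, mul_zero]
        intro v hv
        rw [eq_inv_mul_iff_mul_eq, ← word_cons] at hv
        exact absurd (word_injective hv) (by simp)
    | cons b u =>
      have h1 : ((1 : Matrix ι ι (NCLaurent α)) i j).coeff (word (b :: u)) = 0 := by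
        have h : word (b :: u) ≠ 1 := fun h => absurd (word_injective h : b :: u = []) (by simp)
        rw [Matrix.one_apply]
        split_ifs <;> simp [coeff_one, h]
      rw [h1, zero_add, Finset.sum_eq_single b, wordMatrix_cons, Matrix.mul_apply]
      · refine Finset.sum_congr rfl fun l _ => ?_
        rw [word_cons, inv_mul_cancel_left, coeff_geomSeries]
      · intro a _ hab
        refine Finset.sum_eq_zero fun l _ => ?_
        rw [coeff_geomSeries_of_forall_ne, mul_zero]
        intro v hv
        rw [eq_inv_mul_iff_mul_eq, ← word_cons] at hv
        exact hab (List.cons.inj (word_injective hv)).1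
      · simp
  · push Not at hg
    have h1 : ((1 : Matrix ι ι (NCLaurent α)) i j).coeff g = 0 := by
      have h : g ≠ 1 := fun h => hg [] (by rw [word_nil, h])
      rw [Matrix.one_apply]
      split_ifs <;> simp [coeff_one, h]
    rw [h1, coeff_geomSeries_of_forall_ne μ i j hg, Finset.sum_eq_zero, add_zero]
    intro a _
    refine Finset.sum_eq_zero fun l _ => ?_
    rw [coeff_geomSeries_of_forall_ne, mul_zero]
    intro v hv
    rw [eq_inv_mul_iff_mul_eq, ← word_cons] at hv
    exact hg _ hv

theorem one_sub_letterMatrix_mul_geomSeries :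
    (1 - letterMatrix FreeGroup.of μ) * geomSeries μ = 1 := by
  rw [sub_mul, one_mul, sub_eq_iff_eq_add]
  exact geomSeries_eq μ

theorem geomSeries_mul_one_sub_letterMatrix :
    geomSeries μ * (1 - letterMatrix FreeGroup.of μ) = 1 := by
  -- The difference of the two sides is annihilated by `1 - Q` from the left.
  refine sub_eq_zero.mp (eq_zero_of_letterMatrix_mul_eq (μ := μ) ?_)
  have h : (1 - letterMatrix FreeGroup.of μ) *
      (geomSeries μ * (1 - letterMatrix FreeGroup.of μ) - 1) = 0 := by
    rw [mul_sub, ← mul_assoc, one_sub_letterMatrix_mul_geomSeries, one_mul, mul_one, sub_self]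
  rw [sub_mul, one_mul, sub_eq_zero] at h
  exact h.symm

/-- The geometric series is the only right inverse of `1 - Q`. -/
theorem eq_geomSeries {R : Matrix ι ι (NCLaurent α)}
    (h : (1 - letterMatrix FreeGroup.of μ) * R = 1) : R = geomSeries μ := by
  rw [← one_mul R, ← geomSeries_mul_one_sub_letterMatrix μ, mul_assoc, h, mul_one]

end GeomSeries

end NCLaurent

/-! ### Descent sets in right-angled Coxeter groups -/

namespace CoxeterMatrix

variable {B : Type*} {M : CoxeterMatrix B}

open Classical in
/-- The action of a simple reflection on the coordinates of a point, the values at the point of the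
simple roots: the coordinate `i` changes sign, and it is added twice to the coordinates of the
generators that do not commute with `i`. -/
noncomputable def fire (M : CoxeterMatrix B) (i : B) (x : B → ℤ) : B → ℤ :=
  fun j => if j = i then -x i else if M i j = 0 then x j + 2 * x i else x j

theorem fire_self (i : B) (x : B → ℤ) : M.fire i x i = -x i := by simp [fire]

theorem fire_of_eq_zero {i j : B} (h : M i j = 0) (x : B → ℤ) :
    M.fire i x j = x j + 2 * x i := by
  have : j ≠ i := by
    rintro rfl
    simp at h
  simp [fire, this, h]

theorem fire_of_eq_two {i j : B} (h : M i j = 2) (x : B → ℤ) : M.fire i x j = x j := by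
  have : j ≠ i := by
    rintro rfl
    simp at h
  simp [fire, this, h]

theorem fire_fire (i : B) (x : B → ℤ) : M.fire i (M.fire i x) = x := by
  funext j
  by_cases hj : j = i
  · simp [fire, hj]
  · by_cases h : M i j = 0 <;> simp [fire, hj, h]

theorem fire_comm {i j : B} (h : M i j = 2) (x : B → ℤ) :
    M.fire i (M.fire j x) = M.fire j (M.fire i x) := by
  have hji : M j i = 2 := by rw [M.symmetric, h]
  have hne : i ≠ j := by
    rintro rfl
    simp at h
  funext l
  by_cases hli : l = i
  · subst hli
    rw [fire_self, fire_of_eq_two hji, fire_of_eq_two hji, fire_self]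
  by_cases hlj : l = j
  · subst hlj
    rw [fire_self, fire_of_eq_two h, fire_of_eq_two h, fire_self]
  simp only [fire, hli, hlj, hne, hne.symm, h, hji, if_false, OfNat.ofNat_ne_zero]
  split_ifs <;> ring

/-- The permutation of the coordinate vectors given by a simple reflection. -/
noncomputable def firePerm (M : CoxeterMatrix B) (i : B) : Equiv.Perm (B → ℤ) :=
  Function.Involutive.toPerm (M.fire i) (fire_fire i)

theorem isLiftable_firePerm (hM : M.IsRightAngled) : M.IsLiftable M.firePerm := by
  intro i j
  by_cases hij : i = j
  · subst hij
    rw [M.diagonal, pow_one]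
    exact Equiv.ext (fire_fire i)
  · rcases hM i j hij with h | h
    · rw [h, pow_two]
      ext1 x
      change M.fire i (M.fire j (M.fire i (M.fire j x))) = x
      rw [fire_comm h, fire_fire, fire_fire]
    · rw [h, pow_zero]

end CoxeterMatrix

namespace CoxeterSystem

variable {B : Type*} {M : CoxeterMatrix B} {W : Type*} [Group W] (cs : CoxeterSystem M W)

theorem simple_mul_comm {i j : B} (h : M i j = 2) :
    cs.simple i * cs.simple j = cs.simple j * cs.simple i := by
  have hr := cs.simple_mul_simple_pow i j
  rw [h, pow_two] at hr
  have := eq_inv_of_mul_eq_one_left hr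
  rwa [mul_inv_rev, cs.inv_simple, cs.inv_simple] at this

/-- The coordinates of the image under `w` of a point all of whose coordinates are `1`, which lies
in the interior of the fundamental chamber. -/
noncomputable def chamberPoint (hM : M.IsRightAngled) (w : W) : B → ℤ :=
  cs.lift ⟨_, CoxeterMatrix.isLiftable_firePerm hM⟩ w 1

theorem chamberPoint_simple_mul (hM : M.IsRightAngled) (i : B) (w : W) :
    cs.chamberPoint hM (cs.simple i * w) = M.fire i (cs.chamberPoint hM w) := by
  rw [chamberPoint, map_mul, cs.lift_apply_simple]
  rfl

theorem chamberPoint_one (hM : M.IsRightAngled) : cs.chamberPoint hM 1 = 1 := by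
  rw [chamberPoint, map_one (cs.lift _)]
  rfl

/-- The sign of a coordinate of the chamber point detects the descents. The second property is what
makes the induction on the length of `w` work: it keeps the coordinates of generators that do not
commute with a descent positive. -/
theorem chamberPoint_spec (hM : M.IsRightAngled) (w : W) :
    (∀ i, cs.chamberPoint hM w i ≠ 0) ∧
    (∀ i j, M i j = 0 → cs.chamberPoint hM w i < 0 →
      0 ≤ cs.chamberPoint hM w i + cs.chamberPoint hM w j) ∧
    (∀ i, cs.chamberPoint hM w i < 0 ↔ cs.IsLeftDescent w i) := by
  induction hn : cs.length w using Nat.strong_induction_on generalizing w with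
  | _ n ih =>
  subst hn
  by_cases hw : w = 1
  · subst hw
    simp [chamberPoint_one, not_isLeftDescent_one]
  obtain ⟨s, hs⟩ := cs.exists_leftDescent_of_ne_one hw
  obtain ⟨v, rfl⟩ : ∃ v, w = cs.simple s * v := ⟨cs.simple s * w, by simp⟩
  have hlt : cs.length v < cs.length (cs.simple s * v) := by
    simpa [IsLeftDescent] using hs
  obtain ⟨h0, h1, h2⟩ := ih _ hlt v rfl
  have hlen : cs.length (cs.simple s * v) = cs.length v + 1 := by
    rcases cs.length_simple_mul v s with h | h <;> omega
  set x := cs.chamberPoint hM v with hx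
  have hsv : ¬ cs.IsLeftDescent v s := by
    rw [IsLeftDescent]; omega
  have hxs : 0 < x s := by
    have := h0 s
    have := (h2 s).not.mpr hsv
    omega
  have hpos : ∀ j, M s j = 0 → 0 < x j + 2 * x s := by
    intro j hj
    have := h0 j
    by_cases hneg : x j < 0
    · have := h1 j s (by rw [M.symmetric, hj]) hneg
      omega
    · omega
  rw [chamberPoint_simple_mul, ← hx]
  have cases_s : ∀ j, j = s ∨ M s j = 2 ∨ M s j = 0 := fun j => by
    by_cases h : j = s
    · exact Or.inl h
    · exact Or.inr (hM s j (Ne.symm h))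
  have himp : ∀ i, M.fire s x i < 0 → cs.IsLeftDescent (cs.simple s * v) i := by
    intro i hi
    rcases cases_s i with rfl | h | h
    · exact hs
    · rw [CoxeterMatrix.fire_of_eq_two h] at hi
      have hd := (h2 i).mp hi
      have hc : cs.simple i * (cs.simple s * v) = cs.simple s * (cs.simple i * v) := by
        rw [← mul_assoc, ← cs.simple_mul_comm h, mul_assoc]
      have hle := cs.length_mul_le (cs.simple s) (cs.simple i * v)
      rw [cs.length_simple] at hle
      rw [IsLeftDescent] at hd ⊢
      rw [hc]
      omega
    · rw [CoxeterMatrix.fire_of_eq_zero h] at hi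
      have := hpos i h
      omega
  refine ⟨?_, ?_, fun i => ⟨himp i, fun hi => ?_⟩⟩
  · intro j
    rcases cases_s j with rfl | h | h
    · rw [CoxeterMatrix.fire_self]; omega
    · rw [CoxeterMatrix.fire_of_eq_two h]; exact h0 j
    · rw [CoxeterMatrix.fire_of_eq_zero h]
      exact (hpos j h).ne'
  · intro i j hij hi
    rcases cases_s i with rfl | h | h
    · rw [CoxeterMatrix.fire_self, CoxeterMatrix.fire_of_eq_zero hij]
      by_cases hneg : x j < 0
      · have := h1 j i (by rw [M.symmetric, hij]) hneg
        omega
      · omega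
    · rw [CoxeterMatrix.fire_of_eq_two h] at hi ⊢
      have := h1 i j hij hi
      rcases cases_s j with rfl | h' | h'
      · rw [M.symmetric, h] at hij
        omega
      · rw [CoxeterMatrix.fire_of_eq_two h']
        exact this
      · rw [CoxeterMatrix.fire_of_eq_zero h']
        omega
    · rw [CoxeterMatrix.fire_of_eq_zero h] at hi
      have := hpos i h
      omega
  · -- If `i` is a descent of `s v` and the coordinate were positive, it would be negative for the
    -- shorter element `i s v`, which would then have the descent `i` as well.
    by_contra hneg
    have hi' : cs.length (cs.simple i * (cs.simple s * v)) < cs.length (cs.simple s * v) := hi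
    obtain ⟨g0, -, g2⟩ := ih _ hi' _ rfl
    have e : cs.chamberPoint hM (cs.simple i * (cs.simple s * v)) i = -M.fire s x i := by
      rw [chamberPoint_simple_mul, CoxeterMatrix.fire_self, chamberPoint_simple_mul]
    have g0' := g0 i
    have g2' := (cs.isLeftDescent_iff_not_isLeftDescent_mul.mp hi)
    rw [← g2 i] at g2'
    rw [e] at g0' g2'
    omega

theorem isLeftDescent_simple_mul_of_eq_two (hM : M.IsRightAngled) {i j : B} (h : M i j = 2)
    (w : W) :
    cs.IsLeftDescent (cs.simple i * w) j ↔ cs.IsLeftDescent w j := by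
  rw [← (cs.chamberPoint_spec hM _).2.2, ← (cs.chamberPoint_spec hM _).2.2,
    chamberPoint_simple_mul, CoxeterMatrix.fire_of_eq_two h]

theorem eq_two_of_isLeftDescent (hM : M.IsRightAngled) {w : W} {i j : B} (hi : cs.IsLeftDescent w i)
    (hj : cs.IsLeftDescent w j) (hij : i ≠ j) : M i j = 2 := by
  refine (hM i j hij).resolve_right fun h => ?_
  obtain ⟨-, h1, h2⟩ := cs.chamberPoint_spec hM w
  rw [← h2] at hi hj
  have := h1 i j h hi
  omega

end CoxeterSystem

/-! ### Spherical subsets and the greedy normal form -/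

/-- A set of pairwise commuting generators. In the right-angled case these are the spherical
subsets, that is, the simplices of the nerve, with the empty one included. -/
def CoxeterMatrix.IsClique {B : Type*} (M : CoxeterMatrix B) (σ : Finset B) : Prop :=
  (σ : Set B).Pairwise fun i j => M i j = 2

theorem CoxeterMatrix.IsClique.mono {B : Type*} {M : CoxeterMatrix B} {σ τ : Finset B}
    (h : M.IsClique σ) (hτ : τ ⊆ σ) : M.IsClique τ :=
  Set.Pairwise.mono (by exact_mod_cast hτ) h

namespace CoxeterSystem

variable {B : Type*} {M : CoxeterMatrix B} {W : Type*} [Group W] (cs : CoxeterSystem M W)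

theorem simple_mem_parabolic {σ : Finset B} {i : B} (hi : i ∈ σ) :
    cs.simple i ∈ cs.parabolic σ :=
  Subgroup.subset_closure ⟨i, hi, rfl⟩

theorem isLeftDescent_longest (σ : cs.ProperNerve) {i : B} (hi : i ∈ σ.1) :
    cs.IsLeftDescent (cs.longest σ) i := by
  obtain ⟨h1, h2⟩ := (cs.exists_longest σ).choose_spec
  exact lt_of_le_of_ne (h2 _ (mul_mem (cs.simple_mem_parabolic hi) h1))
    (cs.length_simple_mul_ne _ i)

theorem finite_parabolic_of_isClique {σ : Finset B} (hσ : M.IsClique σ) :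
    (cs.parabolic σ : Set W).Finite := by
  classical
  induction σ using Finset.induction_on with
  | empty => simp [parabolic]
  | insert a τ ha ih =>
    have hτ := ih (hσ.mono (Finset.subset_insert a τ))
    refine (hτ.union (hτ.image (cs.simple a * ·))).subset fun x hx => ?_
    have hstep : ∀ b ∈ insert a τ, ∀ y ∈ (cs.parabolic τ : Set W) ∪
        (cs.simple a * ·) '' (cs.parabolic τ : Set W), cs.simple b * y ∈
          (cs.parabolic τ : Set W) ∪ (cs.simple a * ·) '' (cs.parabolic τ : Set W) := by
      rintro b hb y hy
      rcases Finset.mem_insert.mp hb with rfl | hb'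
      · rcases hy with hy | ⟨y, hy, rfl⟩
        · exact Or.inr ⟨y, hy, rfl⟩
        · exact Or.inl (by simpa using hy)
      · rcases hy with hy | ⟨y, hy, rfl⟩
        · exact Or.inl (mul_mem (cs.simple_mem_parabolic hb') hy)
        · refine Or.inr ⟨cs.simple b * y, mul_mem (cs.simple_mem_parabolic hb') hy, ?_⟩
          have hab : M a b = 2 := hσ (by simp) (by simp [hb'])
            (by rintro rfl; exact ha hb')
          change cs.simple a * (cs.simple b * y) = cs.simple b * (cs.simple a * y)
          rw [← mul_assoc, cs.simple_mul_comm hab, mul_assoc]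
    induction hx using Subgroup.closure_induction_left with
    | one => exact Or.inl (one_mem _)
    | mul_left s hs y _ ih =>
      obtain ⟨b, hb, rfl⟩ := hs
      exact hstep b hb y ih
    | inv_mul_cancel s hs y _ ih =>
      obtain ⟨b, hb, rfl⟩ := hs
      rw [cs.inv_simple]
      exact hstep b hb y ih

/-- If two generators in `σ` did not commute, the longest element of the parabolic subgroup could
not have both of them as descents. -/
theorem mem_nerve_faces_iff (hM : M.IsRightAngled) {σ : Finset B} :
    σ ∈ cs.nerve.faces ↔ σ.Nonempty ∧ M.IsClique σ := by
  constructor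
  · intro h
    refine ⟨h.1, fun i hi j hj hij => ?_⟩
    exact cs.eq_two_of_isLeftDescent hM (cs.isLeftDescent_longest ⟨σ, h⟩ hi)
      (cs.isLeftDescent_longest ⟨σ, h⟩ hj) hij
  · rintro ⟨h1, h2⟩
    exact ⟨h1, cs.finite_parabolic_of_isClique h2⟩

theorem isLeftDescent_mul_of_forall_eq_two (hM : M.IsRightAngled) {σ : Finset B} {i : B}
    (hi : ∀ j ∈ σ, M j i = 2) {x : W} (hx : x ∈ cs.parabolic σ) (w : W) :
    cs.IsLeftDescent (x * w) i ↔ cs.IsLeftDescent w i := by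
  induction hx using Subgroup.closure_induction generalizing w with
  | mem x hx =>
    obtain ⟨j, hj, rfl⟩ := hx
    exact cs.isLeftDescent_simple_mul_of_eq_two hM (hi j hj) w
  | one => rw [one_mul]
  | mul x y _ _ ihx ihy => rw [mul_assoc, ihx, ihy]
  | inv x _ ih => rw [← ih, mul_inv_cancel_left]

theorem isLeftDescent_longest_mul_of_mem (hM : M.IsRightAngled) (σ : cs.ProperNerve) {i : B}
    (hi : i ∈ σ.1) (w : W) :
    cs.IsLeftDescent (cs.longest σ * w) i ↔ ¬ cs.IsLeftDescent w i := by
  have hσ := ((cs.mem_nerve_faces_iff hM).mp σ.2).2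
  -- Every element of the parabolic subgroup either preserves or switches the membership of `i` in
  -- the descent set; the longest element switches it for `w = 1`.
  have key : ∀ x ∈ cs.parabolic σ.1,
      (∀ w, cs.IsLeftDescent (x * w) i ↔ cs.IsLeftDescent w i) ∨
      (∀ w, cs.IsLeftDescent (x * w) i ↔ ¬ cs.IsLeftDescent w i) := by
    intro x hx
    induction hx using Subgroup.closure_induction with
    | mem x hx =>
      obtain ⟨j, hj, rfl⟩ := hx
      by_cases hji : j = i
      · subst hji
        exact Or.inr fun w => by
          rw [cs.isLeftDescent_iff_not_isLeftDescent_mul (w := w), not_not]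
      · exact Or.inl (cs.isLeftDescent_simple_mul_of_eq_two hM (hσ hj hi hji))
    | one => exact Or.inl fun w => by rw [one_mul]
    | mul x y _ _ ihx ihy =>
      rcases ihx with ihx | ihx <;> rcases ihy with ihy | ihy <;>
        simp [mul_assoc, ihx, ihy]
    | inv x _ ih =>
      rcases ih with ih | ih
      · exact Or.inl fun w => by rw [← ih, mul_inv_cancel_left]
      · exact Or.inr fun w => by rw [← not_iff_not, not_not, ← ih, mul_inv_cancel_left]
  rcases key _ (cs.exists_longest σ).choose_spec.1 with h | h
  · have h1 := (h 1).mp (by rw [mul_one]; exact cs.isLeftDescent_longest σ hi)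
    exact absurd h1 (cs.not_isLeftDescent_one i)
  · exact h w

/-- The first letter of a word, with the empty simplex as the default. -/
def headSimplex : List cs.ProperNerve → Finset B
  | [] => ∅
  | σ :: _ => σ.1

theorem headSimplex_cons (σ : cs.ProperNerve) (u : List cs.ProperNerve) :
    cs.headSimplex (σ :: u) = σ.1 := rfl

variable {cs} in
theorem IsGreedy.mem_headSimplex_iff {u : List cs.ProperNerve} (hu : cs.IsGreedy u) (i : B) :
    i ∈ cs.headSimplex u ↔ cs.IsLeftDescent (cs.eval u) i := by
  cases u with
  | nil => simp [headSimplex, eval, not_isLeftDescent_one]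
  | cons σ u => exact hu.1 i

open Classical in
/-- Greediness is a condition on pairs of adjacent letters: the next letter must contain no vertex
of the star of `σ`. A generator that does not commute with some element of `σ` is never a descent,
since descents commute. -/
theorem isGreedy_cons_iff (hM : M.IsRightAngled) (σ : cs.ProperNerve)
    (u : List cs.ProperNerve) : cs.IsGreedy (σ :: u) ↔
      cs.IsGreedy u ∧ ∀ i ∈ cs.headSimplex u, ¬ M.IsClique (insert i σ.1) := by
  have heval : cs.eval (σ :: u) = cs.longest σ * cs.eval u := by simp [eval]
  have hσ := ((cs.mem_nerve_faces_iff hM).mp σ.2).2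
  have hcomm : ∀ i, M.IsClique (insert i σ.1) → i ∉ σ.1 →
      (cs.IsLeftDescent (cs.longest σ * cs.eval u) i ↔ cs.IsLeftDescent (cs.eval u) i) := by
    intro i hi hiσ
    refine cs.isLeftDescent_mul_of_forall_eq_two hM (σ := σ.1) (fun j hj => ?_)
      (cs.exists_longest σ).choose_spec.1 _
    exact hi (by simp [hj]) (by simp) (by rintro rfl; exact hiσ hj)
  rw [IsGreedy, and_comm, heval]
  refine and_congr_right fun hu => ⟨fun h i hi hclique => ?_, fun h i => ?_⟩
  · rw [hu.mem_headSimplex_iff] at hi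
    by_cases hiσ : i ∈ σ.1
    · have := (h i).mp hiσ
      rw [cs.isLeftDescent_longest_mul_of_mem hM σ hiσ] at this
      exact this hi
    · exact hiσ ((h i).mpr ((hcomm i hclique hiσ).mpr hi))
  · simp only [hu.mem_headSimplex_iff] at h
    have hmem : ∀ j ∈ σ.1, cs.IsLeftDescent (cs.longest σ * cs.eval u) j := by
      intro j hj
      rw [cs.isLeftDescent_longest_mul_of_mem hM σ hj]
      intro hd
      exact h j hd (by rwa [Finset.insert_eq_of_mem hj])
    refine ⟨hmem i, fun hd => ?_⟩
    by_contra hiσ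
    by_cases hclique : M.IsClique (insert i σ.1)
    · exact h i ((hcomm i hclique hiσ).mp hd) hclique
    · refine hclique ?_
      intro a ha b hb hab
      have hdesc : ∀ a ∈ insert i σ.1, cs.IsLeftDescent (cs.longest σ * cs.eval u) a := by
        intro a ha
        rcases Finset.mem_insert.mp ha with rfl | ha
        · exact hd
        · exact hmem a ha
      exact cs.eq_two_of_isLeftDescent hM (hdesc a ha) (hdesc b hb) hab

end CoxeterSystem

/-! ### Finite permutation representations of free groups -/

namespace NCLaurent

universe u

/-- Residual finiteness of free groups: some permutation representation on a finite set separates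
all elements of a ball, even at a single point. -/
theorem exists_perm_injOn_ball (α : Type u) [Finite α] [DecidableEq α] (n : ℕ) :
    ∃ (P : Type u) (_ : Fintype P) (π : FreeGroup α →* Equiv.Perm P) (o : P),
      ∀ g h : FreeGroup α, g.norm ≤ n → h.norm ≤ n → π g o = π h o → g = h := by
  classical
  -- The set is the ball itself; each letter acts by a permutation that extends the partial left
  -- translation by it.
  let P := {g : FreeGroup α // g.norm ≤ n}
  have hfin : Finite P :=
    ((List.finite_length_le (α × Bool) n).preimage FreeGroup.toWord_injective.injOn).to_subtype
  let e : ∀ a : α, {x : P // (FreeGroup.of a * x.1).norm ≤ n} ≃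
      {x : P // ((FreeGroup.of a)⁻¹ * x.1).norm ≤ n} := fun a =>
    { toFun := fun x => ⟨⟨FreeGroup.of a * x.1.1, x.2⟩, by
        rw [inv_mul_cancel_left]; exact x.1.2⟩
      invFun := fun x => ⟨⟨(FreeGroup.of a)⁻¹ * x.1.1, x.2⟩, by
        rw [mul_inv_cancel_left]; exact x.1.2⟩
      left_inv := fun x => by simp
      right_inv := fun x => by simp }
  let π : FreeGroup α →* Equiv.Perm P := FreeGroup.lift fun a => (e a).extendSubtype
  have hπ : ∀ (a : α) (x y : P), y.1 = FreeGroup.of a * x.1 → π (FreeGroup.of a) x = y := by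
    intro a x y hxy
    have hx : (FreeGroup.of a * x.1).norm ≤ n := hxy ▸ y.2
    rw [FreeGroup.lift_apply_of, Equiv.extendSubtype_apply_of_mem (e a) x hx]
    exact Subtype.ext hxy.symm
  let o : P := ⟨1, by simp⟩
  have key : ∀ L : List (α × Bool), FreeGroup.IsReduced L → ∀ hL : (FreeGroup.mk L).norm ≤ n,
      π (FreeGroup.mk L) o = ⟨FreeGroup.mk L, hL⟩ := by
    intro L
    induction L with
    | nil =>
      intro _ _
      change π 1 o = _
      rw [map_one]
      rfl
    | cons c L ih =>
      intro hred hL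
      obtain ⟨a, b⟩ := c
      have hred' : FreeGroup.IsReduced L := List.IsChain.tail hred
      have hL' : (FreeGroup.mk L).norm ≤ n := by
        rw [FreeGroup.norm, FreeGroup.toWord_mk, hred.reduce_eq] at hL
        rw [FreeGroup.norm, FreeGroup.toWord_mk, hred'.reduce_eq]
        exact (Nat.le_succ _).trans hL
      have h : FreeGroup.mk ((a, b) :: L) = FreeGroup.mk [(a, b)] * FreeGroup.mk L := by
        rw [FreeGroup.mul_mk]; rfl
      have h' : π (FreeGroup.mk ((a, b) :: L)) o = π (FreeGroup.mk [(a, b)]) ⟨_, hL'⟩ := by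
        rw [h, map_mul, Equiv.Perm.mul_apply, ih hred' hL']
      rw [h']
      cases b
      · have h1 : FreeGroup.mk [(a, false)] = (FreeGroup.of a)⁻¹ := rfl
        rw [h1, map_inv, Equiv.Perm.inv_eq_iff_eq]
        refine (hπ a _ _ ?_).symm
        change FreeGroup.mk L = FreeGroup.of a * FreeGroup.mk ((a, false) :: L)
        rw [h, h1, mul_inv_cancel_left]
      · exact hπ a _ _ h
  refine ⟨P, Fintype.ofFinite P, π, o, fun g h hg hh hgh => ?_⟩
  have h2 : ∀ g : FreeGroup α, ∀ hg : g.norm ≤ n, π g o = ⟨g, hg⟩ := by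
    intro g hg
    have := key g.toWord FreeGroup.isReduced_toWord
    simpa only [FreeGroup.mk_toWord] using this (by rwa [FreeGroup.mk_toWord])
  rw [h2 g hg, h2 h hh] at hgh
  exact congrArg Subtype.val hgh

/-! ### Independence of the representation -/

section Orbit

variable [Finite α] {P : Type*} (π : FreeGroup α →* Equiv.Perm P) (q p : P)

open Classical in
theorem finite_support_orbit (x : NCLaurent α) (m : ℤ) : (Function.support fun g =>
    if degree g = m ∧ π g q = p then x.coeff g else 0).Finite := by
  refine (finite_support_degree x m).subset fun g hg => ?_
  rw [Function.mem_support, ne_eq, ite_eq_right_iff, Classical.not_imp] at hg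
  exact ⟨hg.1.1, hg.2⟩

open Classical in
/-- The image of a noncommutative Laurent series under `g ↦ π g * t ^ degree g`, where `π` is a
permutation representation: the matrix entry at `(p, q)`, a commutative Laurent series in `t`. -/
noncomputable def orbitSeries : NCLaurent α →ₗ[ℚ] LaurentSeries ℚ where
  toFun x := HahnSeries.ofSuppBddBelow
    (fun m => ∑ᶠ g, if degree g = m ∧ π g q = p then x.coeff g else 0) (by
      obtain ⟨n, hn⟩ := x.exists_bound
      refine ⟨-n, fun m hm => ?_⟩
      obtain ⟨g, hg⟩ : ∃ g, (if degree g = m ∧ π g q = p then x.coeff g else 0) ≠ 0 := by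
        by_contra! hc
        exact hm (finsum_eq_zero_of_forall_eq_zero hc)
      rw [ne_eq, ite_eq_right_iff, Classical.not_imp] at hg
      have h1 := hn g hg.2
      have h2 := neg_negCount_le_degree g
      omega)
  map_add' x y := by
    ext m
    simp only [HahnSeries.coeff_ofSuppBddBelow, HahnSeries.coeff_add]
    rw [← finsum_add_distrib (finite_support_orbit π q p x m) (finite_support_orbit π q p y m)]
    refine finsum_congr fun g => ?_
    split_ifs <;> simp
  map_smul' c x := by
    ext m
    simp only [HahnSeries.coeff_ofSuppBddBelow, HahnSeries.coeff_smul, RingHom.id_apply,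
      smul_eq_mul, mul_finsum]
    exact finsum_congr fun g => by simp

open Classical in
theorem coeff_orbitSeries (x : NCLaurent α) (m : ℤ) : (orbitSeries π q p x).coeff m =
    ∑ᶠ g, if degree g = m ∧ π g q = p then x.coeff g else 0 :=
  rfl

theorem orbitSeries_mono_inv_mul (a : α) (x : NCLaurent α) :
    orbitSeries π q p (mono (FreeGroup.of a)⁻¹ * x) =
      HahnSeries.single (-1) 1 * orbitSeries π q (π (FreeGroup.of a) p) x := by
  classical
  ext m
  rw [HahnSeries.coeff_single_mul, one_mul, coeff_orbitSeries, coeff_orbitSeries]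
  refine Eq.trans ?_ (finsum_comp_equiv (Equiv.mulLeft (FreeGroup.of a)))
  refine finsum_congr fun g => ?_
  rw [coeff_mono_mul, inv_inv]
  simp only [Equiv.coe_mulLeft, degree_mul, degree_of, map_mul, Equiv.Perm.mul_apply,
    EmbeddingLike.apply_eq_iff_eq]
  refine if_congr (and_congr_left fun _ => ?_) rfl rfl
  constructor <;> intro h <;> omega

theorem orbitSeries_one [DecidableEq P] :
    orbitSeries π q p (1 : NCLaurent α) = if q = p then 1 else 0 := by
  classical
  ext m
  rw [coeff_orbitSeries, finsum_eq_single _ 1]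
  · by_cases h : q = p
    · simp [h, coeff_one, HahnSeries.coeff_one, eq_comm]
    · simp [h]
  · intro g hg
    simp [coeff_one, hg]

end Orbit

/-- The images in all finite permutation representations determine a Laurent series. -/
theorem eq_zero_of_orbitSeries_eq_zero {α : Type u} [Finite α] {x : NCLaurent α}
    (h : ∀ (P : Type u) [Fintype P] (π : FreeGroup α →* Equiv.Perm P) (q p : P),
      orbitSeries π q p x = 0) : x = 0 := by
  classical
  ext g
  by_contra hg
  obtain ⟨n, hn⟩ := ((finite_support_degree x (degree g)).image FreeGroup.norm).bddAbove
  obtain ⟨P, _, π, o, hπ⟩ := exists_perm_injOn_ball α n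
  have h1 := congrArg (fun s => HahnSeries.coeff s (degree g)) (h P π o (π g o))
  simp only [HahnSeries.coeff_zero] at h1
  rw [coeff_orbitSeries, finsum_eq_single _ g] at h1
  · exact hg (by simpa using h1)
  · intro k hk
    rw [ite_eq_right_iff]
    rintro ⟨hd, hp⟩
    by_contra hx
    exact hk (hπ k g (hn ⟨k, ⟨hd, hx⟩, rfl⟩) (hn ⟨g, ⟨rfl, hg⟩, rfl⟩) hp)

section Uniqueness

variable {α ι : Type*} [Fintype α] [Fintype ι]

/-- The action of `1 - ∑ a, μ a * a⁻¹` on column vectors, transported to the commutative field of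
Laurent series in `t` by a permutation representation. -/
noncomputable def orbitSystem (μ : α → Matrix ι ι ℚ) {P : Type*}
    (π : FreeGroup α →* Equiv.Perm P) :
    (ι → P → LaurentSeries ℚ) →ₗ[LaurentSeries ℚ] (ι → P → LaurentSeries ℚ) where
  toFun v i p := v i p -
    ∑ a, ∑ l, μ a i l • (HahnSeries.single (-1) 1 * v l (π (FreeGroup.of a) p))
  map_add' v w := by
    funext i p
    simp only [Pi.add_apply, mul_add, smul_add, Finset.sum_add_distrib]
    ring
  map_smul' c v := by
    funext i p
    simp only [Pi.smul_apply, smul_eq_mul, RingHom.id_apply, mul_sub, Finset.mul_sum,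
      mul_smul_comm]
    simp only [mul_left_comm]

theorem orbitSystem_apply (μ : α → Matrix ι ι ℚ) {P : Type*} (π : FreeGroup α →* Equiv.Perm P)
    (v : ι → P → LaurentSeries ℚ) (i : ι) (p : P) : orbitSystem μ π v i p = v i p -
      ∑ a, ∑ l, μ a i l • (HahnSeries.single (-1) 1 * v l (π (FreeGroup.of a) p)) := rfl

variable [DecidableEq ι]

theorem orbitSystem_orbitSeries {μ : α → Matrix ι ι ℚ} {R : Matrix ι ι (NCLaurent α)}
    (hR : (1 - letterMatrix (fun a => (FreeGroup.of a)⁻¹) μ) * R = 1) {P : Type*}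
    [DecidableEq P] (π : FreeGroup α →* Equiv.Perm P) (q : P) (j : ι) :
    orbitSystem μ π (fun i p => orbitSeries π q p (R i j)) = Pi.single j (Pi.single q 1) := by
  funext i p
  have h1 : R i j - ∑ l, ∑ a, μ a i l • (mono (FreeGroup.of a)⁻¹ * R l j) =
      if i = j then 1 else 0 := by
    have := congrFun (congrFun hR i) j
    rw [sub_mul, one_mul, Matrix.sub_apply, Matrix.one_apply, Matrix.mul_apply] at this
    simpa only [letterMatrix, Finset.sum_mul, smul_mul] using this
  have h2 := congrArg (orbitSeries π q p) h1
  simp only [map_sub, map_sum, map_smul, orbitSeries_mono_inv_mul] at h2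
  rw [orbitSystem_apply, Finset.sum_comm, h2]
  by_cases hij : i = j
  · subst hij
    rw [if_pos rfl, orbitSeries_one, Pi.single_eq_same, Pi.single_apply]
    exact if_congr eq_comm rfl rfl
  · rw [if_neg hij, map_zero, Pi.single_eq_of_ne hij, Pi.zero_apply]

/-- A representation of the zero series has reciprocal zero. Over the field of commutative Laurent
series, `1 - ∑ a, μ a * t⁻¹ * π a⁻¹` is a surjective, hence bijective, endomorphism of a
finite-dimensional space. It maps the space of vectors annihilated by all row vectors `A * μ u` to
itself, hence bijectively, so the solution with the right-hand side `C` lies in this space. -/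
theorem sum_smul_eq_zero_of_wordMatrix {μ : α → Matrix ι ι ℚ} {A C : ι → ℚ}
    {R : Matrix ι ι (NCLaurent α)}
    (hR : (1 - letterMatrix (fun a => (FreeGroup.of a)⁻¹) μ) * R = 1)
    (h0 : ∀ u, Matrix.vecMul A (wordMatrix μ u) ⬝ᵥ C = 0) :
    ∑ i, ∑ j, (A i * C j) • R i j = 0 := by
  classical
  refine eq_zero_of_orbitSeries_eq_zero fun P _ π q p => ?_
  let T := orbitSystem μ π
  have hsingle : ∀ j i : ι, ∀ q p : P,
      (Pi.single j (Pi.single q 1) : ι → P → LaurentSeries ℚ) i p =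
        if i = j then if p = q then 1 else 0 else 0 := by
    intro j i q p
    rw [Pi.single_apply]
    split_ifs <;> simp_all
  have hsurj : Function.Surjective T := by
    rw [← LinearMap.range_eq_top, eq_top_iff]
    rintro v -
    have hv : v = ∑ j, ∑ q, v j q •
        (Pi.single j (Pi.single q 1) : ι → P → LaurentSeries ℚ) := by
      funext i p
      simp [Finset.sum_apply, hsingle]
    rw [hv]
    refine Submodule.sum_mem _ fun j _ => Submodule.sum_mem _ fun q _ =>
      Submodule.smul_mem _ _ ⟨_, orbitSystem_orbitSeries hR π q j⟩
  have hinj : Function.Injective T := LinearMap.injective_iff_surjective.mpr hsurj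
  let U : Submodule (LaurentSeries ℚ) (ι → P → LaurentSeries ℚ) :=
    { carrier := {v | ∀ u p, ∑ i, Matrix.vecMul A (wordMatrix μ u) i • v i p = 0}
      zero_mem' := by simp
      add_mem' := fun {v w} hv hw u p => by
        simp only [Pi.add_apply, smul_add, Finset.sum_add_distrib, hv u p, hw u p, add_zero]
      smul_mem' := fun c v hv u p => by
        simp only [Pi.smul_apply, smul_eq_mul, ← mul_smul_comm, ← Finset.mul_sum, hv u p,
          mul_zero] }
  have hTU : ∀ v ∈ U, T v ∈ U := by
    intro v hv u p
    have h1 : ∀ a : α, ∀ l, ∑ i, Matrix.vecMul A (wordMatrix μ u) i * μ a i l =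
        Matrix.vecMul A (wordMatrix μ (u ++ [a])) l := by
      intro a l
      have : wordMatrix μ (u ++ [a]) = wordMatrix μ u * μ a := by simp [wordMatrix]
      rw [this, ← Matrix.vecMul_vecMul]
      rfl
    have h2 : ∑ i, Matrix.vecMul A (wordMatrix μ u) i • T v i p =
        ∑ i, Matrix.vecMul A (wordMatrix μ u) i • v i p -
        ∑ a, HahnSeries.single (-1) 1 * ∑ l, Matrix.vecMul A (wordMatrix μ (u ++ [a])) l •
          v l (π (FreeGroup.of a) p) := by
      simp only [T, orbitSystem_apply, smul_sub, Finset.sum_sub_distrib, Finset.smul_sum,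
        Finset.mul_sum, smul_smul, ← h1, Finset.sum_smul, mul_smul_comm]
      congr 1
      rw [Finset.sum_comm]
      exact Finset.sum_congr rfl fun a _ => Finset.sum_comm
    rw [h2, hv u p, zero_sub, neg_eq_zero]
    exact Finset.sum_eq_zero fun a _ => by rw [hv, mul_zero]
  have hUsurj : Function.Surjective (T.restrict hTU) :=
    LinearMap.injective_iff_surjective.mp fun x y hxy =>
      Subtype.ext (hinj (congrArg Subtype.val hxy))
  let X : ι → P → LaurentSeries ℚ := ∑ j, C j • fun i p => orbitSeries π q p (R i j)
  have hTX : T X = ∑ j, C j • (Pi.single j (Pi.single q 1) : ι → P → LaurentSeries ℚ) := by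
    rw [map_sum]
    refine Finset.sum_congr rfl fun j _ => ?_
    rw [← orbitSystem_orbitSeries hR π q j]
    exact (T.restrictScalars ℚ).map_smul (C j) _
  have hCU : T X ∈ U := by
    intro u p
    rw [hTX]
    have h := h0 u
    rw [dotProduct] at h
    by_cases hp : p = q
    · simp only [Finset.sum_apply, Pi.smul_apply, hsingle, hp, if_true, smul_ite, smul_zero,
        Finset.sum_ite_eq, Finset.mem_univ, smul_smul, ← Finset.sum_smul, h, zero_smul]
    · simp [Finset.sum_apply, hsingle, hp]
  obtain ⟨Y, hY⟩ := hUsurj ⟨T X, hCU⟩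
  have hXU : X ∈ U := by
    rw [← hinj (congrArg Subtype.val hY)]
    exact Y.2
  have h := hXU [] p
  simp only [wordMatrix_nil, Matrix.vecMul_one, X, Finset.sum_apply, Pi.smul_apply,
    Finset.smul_sum, smul_smul] at h
  simpa only [map_sum, map_smul] using h

end Uniqueness

section Representations

variable {α : Type*} [Fintype α]

/-- The coefficient matrix of a letter in a matrix of linear homogeneous polynomials. -/
def letterCoeff {ι : Type*} (Q : Matrix ι ι (MonoidAlgebra ℚ (FreeGroup α))) (a : α) :
    Matrix ι ι ℚ :=
  fun i j => (Q i j).coeff (FreeGroup.of a)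

theorem map_ofPoly_eq {ι : Type*} {Q : Matrix ι ι (MonoidAlgebra ℚ (FreeGroup α))}
    (hQ : ∀ i j, IsLinearHomogeneous (Q i j)) :
    Q.map ofPoly = letterMatrix FreeGroup.of (letterCoeff Q) := by
  ext1 i j
  exact (hQ i j).ofPoly_eq

theorem map_bar_map_ofPoly_eq {ι : Type*} {Q : Matrix ι ι (MonoidAlgebra ℚ (FreeGroup α))}
    (hQ : ∀ i j, IsLinearHomogeneous (Q i j)) :
    (Q.map bar).map ofPoly = letterMatrix (fun a => (FreeGroup.of a)⁻¹) (letterCoeff Q) := by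
  ext1 i j
  exact (hQ i j).ofPoly_bar_eq

theorem coeff_sum_smul_geomSeries {ι : Type*} [Fintype ι] [DecidableEq ι] (μ : α → Matrix ι ι ℚ)
    (A C : ι → ℚ) (u : List α) :
    (∑ i, ∑ j, (A i * C j) • geomSeries μ i j).coeff (word u) =
      Matrix.vecMul A (wordMatrix μ u) ⬝ᵥ C := by
  simp only [coeff_sum, coeff_smul, coeff_geomSeries, dotProduct, Matrix.vecMul, Finset.sum_mul]
  rw [Finset.sum_comm]
  exact Finset.sum_congr rfl fun j _ => Finset.sum_congr rfl fun i _ => by ring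

theorem letterMatrix_fromBlocks {ι κ : Type*} (f : α → FreeGroup α) (μ : α → Matrix ι ι ℚ)
    (ν : α → Matrix κ κ ℚ) :
    letterMatrix f (fun a => Matrix.fromBlocks (μ a) 0 0 (ν a)) =
      Matrix.fromBlocks (letterMatrix f μ) 0 0 (letterMatrix f ν) := by
  ext1 i j
  rcases i with i | i <;> rcases j with j | j <;> simp [letterMatrix]

omit [Fintype α] in
theorem wordMatrix_fromBlocks {ι κ : Type*} [Fintype ι] [DecidableEq ι] [Fintype κ]
    [DecidableEq κ] (μ : α → Matrix ι ι ℚ) (ν : α → Matrix κ κ ℚ) (u : List α) :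
    wordMatrix (fun a => Matrix.fromBlocks (μ a) 0 0 (ν a)) u =
      Matrix.fromBlocks (wordMatrix μ u) 0 0 (wordMatrix ν u) := by
  induction u with
  | nil => simp
  | cons a u ih => simp [ih, Matrix.fromBlocks_multiply]

/-- The value of the reciprocal does not depend on the representation: the difference of two
representations of the same series represents zero. -/
theorem sandwich_eq_sandwich {x : NCLaurent α} {n m : ℕ} {A₁ C₁ : Fin n → ℚ} {A₂ C₂ : Fin m → ℚ}
    {Q₁ : Matrix (Fin n) (Fin n) (MonoidAlgebra ℚ (FreeGroup α))}
    {Q₂ : Matrix (Fin m) (Fin m) (MonoidAlgebra ℚ (FreeGroup α))}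
    (h₁ : IsRepresentation x A₁ Q₁ C₁) (h₂ : IsRepresentation x A₂ Q₂ C₂)
    {R₁ : Matrix (Fin n) (Fin n) (NCLaurent α)} {R₂ : Matrix (Fin m) (Fin m) (NCLaurent α)}
    (hR₁ : IsInverse (1 - (Q₁.map bar).map ofPoly) R₁)
    (hR₂ : IsInverse (1 - (Q₂.map bar).map ofPoly) R₂) :
    sandwich A₁ R₁ C₁ = sandwich A₂ R₂ C₂ := by
  obtain ⟨hQ₁, S₁, hS₁, hx₁⟩ := h₁
  obtain ⟨hQ₂, S₂, hS₂, hx₂⟩ := h₂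
  rw [map_ofPoly_eq hQ₁] at hS₁
  rw [map_ofPoly_eq hQ₂] at hS₂
  rw [eq_geomSeries _ hS₁.1] at hx₁
  rw [eq_geomSeries _ hS₂.1] at hx₂
  rw [map_bar_map_ofPoly_eq hQ₁] at hR₁
  rw [map_bar_map_ofPoly_eq hQ₂] at hR₂
  have key := sum_smul_eq_zero_of_wordMatrix
    (μ := fun a => Matrix.fromBlocks (letterCoeff Q₁ a) 0 0 (letterCoeff Q₂ a))
    (A := Sum.elim A₁ (-A₂)) (C := Sum.elim C₁ C₂) (R := Matrix.fromBlocks R₁ 0 0 R₂) ?_ ?_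
  · rw [← sub_eq_zero]
    simpa [sandwich, sub_eq_add_neg] using key
  · have h1 : (1 - letterMatrix (fun a => (FreeGroup.of a)⁻¹) (letterCoeff Q₁)) * R₁ = 1 := hR₁.1
    have h2 : (1 - letterMatrix (fun a => (FreeGroup.of a)⁻¹) (letterCoeff Q₂)) * R₂ = 1 := hR₂.1
    rw [sub_mul, one_mul, sub_eq_iff_eq_add] at h1 h2 ⊢
    rw [letterMatrix_fromBlocks, Matrix.fromBlocks_multiply, ← Matrix.fromBlocks_one,
      Matrix.fromBlocks_add]
    simp [← h1, ← h2]
  · intro u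
    have h := congrArg (fun y => y.coeff (word u)) (hx₁.symm.trans hx₂)
    simp only [sandwich, coeff_sum_smul_geomSeries] at h
    rw [wordMatrix_fromBlocks, Matrix.vecMul_fromBlocks]
    simp [Matrix.neg_vecMul, h]

/-- The reciprocal of a series is computed from a representation indexed by any finite type. -/
theorem isReciprocal_of_isInverse {ι : Type*} [Fintype ι] [DecidableEq ι]
    (μ : α → Matrix ι ι ℚ) (A C : ι → ℚ) {R : Matrix ι ι (NCLaurent α)}
    (hR : (1 - letterMatrix (fun a => (FreeGroup.of a)⁻¹) μ) * R = 1)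
    (hR' : R * (1 - letterMatrix (fun a => (FreeGroup.of a)⁻¹) μ) = 1) :
    IsReciprocal (∑ i, ∑ j, (A i * C j) • geomSeries μ i j) (∑ i, ∑ j, (A i * C j) • R i j) := by
  classical
  let e := Fintype.equivFin ι
  let Q : Matrix (Fin (Fintype.card ι)) (Fin (Fintype.card ι)) (MonoidAlgebra ℚ (FreeGroup α)) :=
    fun i j => ∑ a, MonoidAlgebra.single (FreeGroup.of a) (μ a (e.symm i) (e.symm j))
  have hcoeff : ∀ i j g, (Q i j).coeff g =
      ∑ a, if FreeGroup.of a = g then μ a (e.symm i) (e.symm j) else 0 := by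
    intro i j g
    simp [Q, MonoidAlgebra.coeff_sum, Finsupp.single_apply]
  have hQ : ∀ i j, IsLinearHomogeneous (Q i j) := by
    intro i j g hg
    rw [hcoeff] at hg
    obtain ⟨a, -, ha⟩ := Finset.exists_ne_zero_of_sum_ne_zero hg
    exact ⟨a, by by_contra h; exact ha (if_neg fun h' => h h'.symm)⟩
  have hQμ : ∀ f : α → FreeGroup α, letterMatrix f (letterCoeff Q) =
      (letterMatrix f μ).submatrix e.symm e.symm := by
    intro f
    ext1 i j
    simp [letterMatrix, letterCoeff, hcoeff, FreeGroup.of_injective.eq_iff]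
  have hinv : ∀ (f : α → FreeGroup α) (S : Matrix ι ι (NCLaurent α)),
      (1 - letterMatrix f μ) * S = 1 → S * (1 - letterMatrix f μ) = 1 →
      IsInverse (1 - letterMatrix f (letterCoeff Q)) (S.submatrix e.symm e.symm) := by
    intro f S h1 h2
    have h : 1 - letterMatrix f (letterCoeff Q) =
        (1 - letterMatrix f μ).submatrix e.symm e.symm := by
      rw [hQμ, Matrix.submatrix_sub, Pi.sub_apply, Pi.sub_apply, Matrix.submatrix_one_equiv]
    rw [h]
    constructor
    · rw [Matrix.submatrix_mul_equiv, h1, Matrix.submatrix_one_equiv]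
    · rw [Matrix.submatrix_mul_equiv, h2, Matrix.submatrix_one_equiv]
  have hsum : ∀ S : Matrix ι ι (NCLaurent α), ∑ i, ∑ j, (A i * C j) • S i j =
      sandwich (A ∘ e.symm) (S.submatrix e.symm e.symm) (C ∘ e.symm) := by
    intro S
    rw [sandwich, ← Equiv.sum_comp e.symm]
    refine Finset.sum_congr rfl fun i _ => ?_
    rw [← Equiv.sum_comp e.symm]
    rfl
  have hrep : IsRepresentation (∑ i, ∑ j, (A i * C j) • geomSeries μ i j) (A ∘ e.symm) Q
      (C ∘ e.symm) := by
    refine ⟨hQ, _, ?_, hsum (geomSeries μ)⟩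
    rw [map_ofPoly_eq hQ]
    exact hinv _ _ (one_sub_letterMatrix_mul_geomSeries μ) (geomSeries_mul_one_sub_letterMatrix μ)
  have hbar : IsInverse (1 - (Q.map bar).map ofPoly) (R.submatrix e.symm e.symm) := by
    rw [map_bar_map_ofPoly_eq hQ]
    exact hinv _ _ hR hR'
  refine ⟨⟨_, _, Q, _, hrep, _, hbar⟩, fun n A' Q' C' hrep' R' hR'' => ?_⟩
  rw [hsum]
  exact sandwich_eq_sandwich hrep' hrep hR'' hbar

end Representations

end NCLaurent

/-! ### Incidence matrices of the nerve -/

namespace CoxeterMatrix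

variable {B : Type*} (M : CoxeterMatrix B)

/-- The simplices of the nerve of a right-angled Coxeter group, the empty one included. -/
abbrev Simplex : Type _ := {σ : Finset B // M.IsClique σ}

/-- The empty simplex. -/
def emptySimplex : M.Simplex := ⟨∅, by simp [IsClique]⟩

/-- The diagonal matrix of the signs `(-1) ^ card σ`. -/
noncomputable def signMatrix [DecidableEq B] : Matrix M.Simplex M.Simplex ℚ :=
  Matrix.diagonal fun σ => (-1) ^ σ.1.card

open Classical in
/-- The incidence matrix of the face relation. -/
noncomputable def faceMatrix : Matrix M.Simplex M.Simplex ℚ :=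
  fun σ τ => if σ.1 ⊆ τ.1 then 1 else 0

open Classical in
/-- The transition matrix of the greedy normal form: the entry at `(σ, ρ)` is `1` if `ρ` contains
no vertex of the star of `σ`. -/
noncomputable def greedyMatrix [DecidableEq B] : Matrix M.Simplex M.Simplex ℚ :=
  fun σ ρ => if ∀ i ∈ ρ.1, ¬ M.IsClique (insert i σ.1) then 1 else 0

variable {M}

theorem greedyMatrix_apply [DecidableEq B] (σ ρ : M.Simplex)
    [Decidable (∀ i ∈ ρ.1, ¬ M.IsClique (insert i σ.1))] :
    M.greedyMatrix σ ρ = if ∀ i ∈ ρ.1, ¬ M.IsClique (insert i σ.1) then 1 else 0 := by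
  rw [greedyMatrix]
  congr

theorem signMatrix_mul_self [Fintype B] [DecidableEq B] [Fintype M.Simplex] :
    M.signMatrix * M.signMatrix = 1 := by
  rw [signMatrix, Matrix.diagonal_mul_diagonal, ← Matrix.diagonal_one]
  congr 1
  funext σ
  rw [← pow_add, ← two_mul, pow_mul]
  simp

theorem sum_Icc_neg_one_pow_card [DecidableEq B] {σ ρ : Finset B} (h : σ ⊆ ρ) :
    ∑ τ ∈ Finset.Icc σ ρ, (-1 : ℚ) ^ τ.card = if σ = ρ then (-1) ^ σ.card else 0 := by
  have hinj : Set.InjOn (σ ∪ ·) ((ρ \ σ).powerset : Set (Finset B)) := by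
    intro a ha b hb hab
    simp only [Finset.coe_powerset, Set.mem_preimage, Set.mem_powerset_iff,
      Finset.coe_subset, Finset.subset_sdiff] at ha hb
    have := congrArg (· \ σ) hab
    simpa [Finset.union_sdiff_left, Finset.sdiff_eq_self_of_disjoint ha.2,
      Finset.sdiff_eq_self_of_disjoint hb.2] using this
  rw [Finset.Icc_eq_image_powerset h, Finset.sum_image hinj]
  have hcard : ∀ τ ∈ (ρ \ σ).powerset, (-1 : ℚ) ^ (σ ∪ τ).card =
      (-1) ^ σ.card * (-1) ^ τ.card := by
    intro τ hτ
    rw [Finset.mem_powerset, Finset.subset_sdiff] at hτ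
    rw [Finset.card_union_of_disjoint hτ.2.symm, pow_add]
  rw [Finset.sum_congr rfl hcard, ← Finset.mul_sum]
  have := Finset.sum_powerset_neg_one_pow_card (x := ρ \ σ)
  have hQ : ∑ τ ∈ (ρ \ σ).powerset, (-1 : ℚ) ^ τ.card = if ρ \ σ = ∅ then 1 else 0 := by
    exact_mod_cast congrArg (Int.cast : ℤ → ℚ) this
  rw [hQ]
  have hiff : ρ \ σ = ∅ ↔ σ = ρ := by
    rw [Finset.sdiff_eq_empty_iff_subset]
    exact ⟨fun h' => h.antisymm h', fun h' => h'.ge⟩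
  simp only [hiff, mul_ite, mul_one, mul_zero]

variable [Fintype B] [DecidableEq B] [Fintype M.Simplex]

omit [DecidableEq B] in
/-- A sum over the simplices with a property that only cliques have is a sum over all subsets with
this property. -/
theorem sum_simplex_ite {p : Finset B → Prop} [DecidablePred p] (hp : ∀ τ, p τ → M.IsClique τ)
    (f : Finset B → ℚ) :
    ∑ τ : M.Simplex, (if p τ.1 then f τ.1 else 0) = ∑ τ with p τ, f τ := by
  classical
  have h : ∑ τ with p τ, f τ = ∑ τ with M.IsClique τ, if p τ then f τ else 0 := by
    rw [← Finset.sum_filter, Finset.filter_filter]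
    refine Finset.sum_congr (Finset.filter_congr fun τ _ => ?_) fun _ _ => rfl
    exact ⟨fun h => ⟨hp τ h, h⟩, fun h => h.2⟩
  rw [h]
  exact (Finset.sum_subtype _ (by simp) fun τ => if p τ then f τ else 0).symm

/-- Möbius inversion on the poset of simplices. -/
theorem faceMatrix_mul_sign_mul_faceMatrix_mul_sign :
    M.faceMatrix * M.signMatrix * (M.faceMatrix * M.signMatrix) = 1 := by
  classical
  ext σ ρ
  rw [signMatrix, Matrix.mul_apply]
  simp only [Matrix.mul_diagonal]
  have h : ∀ τ : M.Simplex, M.faceMatrix σ τ * (-1) ^ τ.1.card *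
      (M.faceMatrix τ ρ * (-1) ^ ρ.1.card) =
      (-1) ^ ρ.1.card * if σ.1 ⊆ τ.1 ∧ τ.1 ⊆ ρ.1 then (-1) ^ τ.1.card else 0 := by
    intro τ
    by_cases h1 : σ.1 ⊆ τ.1 <;> by_cases h2 : τ.1 ⊆ ρ.1 <;> simp [faceMatrix, h1, h2, mul_comm]
  simp only [h, ← Finset.mul_sum]
  rw [sum_simplex_ite (p := fun τ => σ.1 ⊆ τ ∧ τ ⊆ ρ.1) (fun τ hτ => ρ.2.mono hτ.2)
    (fun τ => (-1) ^ τ.card)]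
  by_cases hσρ : σ.1 ⊆ ρ.1
  · have : (Finset.univ.filter fun τ => σ.1 ⊆ τ ∧ τ ⊆ ρ.1) = Finset.Icc σ.1 ρ.1 := by
      ext τ; simp
    rw [this, sum_Icc_neg_one_pow_card hσρ, Matrix.one_apply]
    by_cases he : σ = ρ
    · subst he
      simp [← mul_pow]
    · simp [he, Subtype.val_injective.ne he]
  · rw [Finset.sum_eq_zero, mul_zero, Matrix.one_apply_ne]
    · rintro rfl
      exact hσρ subset_rfl
    · intro τ hτ
      rw [Finset.mem_filter] at hτ
      exact absurd (hτ.2.1.trans hτ.2.2) hσρ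

variable {ε : ℚ}

/-- The Eulerian condition expresses that the vertex sets of two simplices lie in a common simplex
by an alternating sum over the common cofaces; inclusion-exclusion over the faces of `ρ` in the star
of `σ` then gives this factorization of the transition matrix. -/
theorem greedyMatrix_eq (hε : ε * ε = 1)
    (hE : ∀ κ : M.Simplex, ∑ ν : M.Simplex, (if κ.1 ⊆ ν.1 then (-1) ^ ν.1.card else 0) = ε) :
    M.greedyMatrix = ε • (M.faceMatrix * M.signMatrix * M.faceMatrix.transpose *
      M.signMatrix * M.faceMatrix) := by
  classical
  have hJ : ∀ σ τ : M.Simplex, (M.faceMatrix * M.signMatrix * M.faceMatrix.transpose) σ τ =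
      if M.IsClique (σ.1 ∪ τ.1) then ε else 0 := by
    intro σ τ
    rw [signMatrix, Matrix.mul_apply]
    simp only [Matrix.mul_diagonal, Matrix.transpose_apply]
    have h : ∀ ν : M.Simplex, M.faceMatrix σ ν * (-1) ^ ν.1.card * M.faceMatrix τ ν =
        if σ.1 ∪ τ.1 ⊆ ν.1 then (-1) ^ ν.1.card else 0 := by
      intro ν
      by_cases h1 : σ.1 ⊆ ν.1 <;> by_cases h2 : τ.1 ⊆ ν.1 <;>
        simp [faceMatrix, h1, h2, Finset.union_subset_iff]
    simp only [h]
    split_ifs with hc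
    · exact hE ⟨_, hc⟩
    · exact Finset.sum_eq_zero fun ν _ => if_neg fun hν => hc (ν.2.mono hν)
  ext σ ρ
  rw [Matrix.smul_apply, Matrix.mul_apply]
  have h : ∀ τ : M.Simplex, (M.faceMatrix * M.signMatrix * M.faceMatrix.transpose *
      M.signMatrix) σ τ * M.faceMatrix τ ρ =
      ε * if M.IsClique (σ.1 ∪ τ.1) ∧ τ.1 ⊆ ρ.1 then (-1) ^ τ.1.card else 0 := by
    intro τ
    rw [signMatrix, Matrix.mul_diagonal, ← signMatrix, hJ]
    by_cases h1 : M.IsClique (σ.1 ∪ τ.1) <;> by_cases h2 : τ.1 ⊆ ρ.1 <;>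
      simp [faceMatrix, h1, h2]
  simp only [h, ← Finset.mul_sum]
  rw [smul_eq_mul, ← mul_assoc, hε, one_mul,
    sum_simplex_ite (p := fun τ => M.IsClique (σ.1 ∪ τ) ∧ τ ⊆ ρ.1)
      (fun τ hτ => ρ.2.mono hτ.2) (fun τ => (-1) ^ τ.card)]
  -- Cliques are determined by their edges, so `σ ∪ τ` is a simplex if and only if all vertices of
  -- `τ` lie in the star of `σ`.
  have hset : (Finset.univ.filter fun τ => M.IsClique (σ.1 ∪ τ) ∧ τ ⊆ ρ.1) =
      (ρ.1.filter fun i => M.IsClique (insert i σ.1)).powerset := by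
    ext τ
    simp only [Finset.mem_filter, Finset.mem_univ, true_and, Finset.mem_powerset]
    constructor
    · rintro ⟨h1, h2⟩ i hi
      refine Finset.mem_filter.mpr ⟨h2 hi, h1.mono ?_⟩
      exact Finset.insert_subset (Finset.mem_union_right _ hi) Finset.subset_union_left
    · intro hτ
      have hτρ : τ ⊆ ρ.1 := hτ.trans (Finset.filter_subset _ _)
      refine ⟨fun i hi j hj hij => ?_, hτρ⟩
      have hst : ∀ i ∈ τ, ∀ j ∈ σ.1, i ≠ j → M i j = 2 := fun i hi j hj hij =>
        (Finset.mem_filter.mp (hτ hi)).2 (by simp) (by simp [hj]) hij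
      rw [Finset.mem_coe, Finset.mem_union] at hi hj
      rcases hi with hi | hi <;> rcases hj with hj | hj
      · exact σ.2 hi hj hij
      · exact (M.symmetric i j).trans (hst j hj i hi hij.symm)
      · exact hst i hi j hj hij
      · exact ρ.2 (hτρ hi) (hτρ hj) hij
  rw [hset]
  have := Finset.sum_powerset_neg_one_pow_card
    (x := ρ.1.filter fun i => M.IsClique (insert i σ.1))
  have hQ : ∑ τ ∈ (ρ.1.filter fun i => M.IsClique (insert i σ.1)).powerset, (-1 : ℚ) ^ τ.card =
      if (ρ.1.filter fun i => M.IsClique (insert i σ.1)) = ∅ then 1 else 0 := by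
    exact_mod_cast congrArg (Int.cast : ℤ → ℚ) this
  rw [hQ]
  rw [greedyMatrix_apply]
  exact if_congr Finset.filter_eq_empty_iff.symm rfl rfl

/-- For an Eulerian sphere, the inverse of the transition matrix is its conjugate by the signs. -/
theorem greedyMatrix_mul_sign_mul_greedyMatrix_mul_sign (hε : ε * ε = 1)
    (hE : ∀ κ : M.Simplex, ∑ ν : M.Simplex, (if κ.1 ⊆ ν.1 then (-1) ^ ν.1.card else 0) = ε) :
    M.greedyMatrix * M.signMatrix * (M.greedyMatrix * M.signMatrix) = 1 := by
  have h1 := M.faceMatrix_mul_sign_mul_faceMatrix_mul_sign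
  have h2 : M.faceMatrix.transpose * M.signMatrix * (M.faceMatrix.transpose * M.signMatrix) =
      1 := by
    have h3 : M.signMatrix * M.faceMatrix * (M.signMatrix * M.faceMatrix) = 1 := by
      have h4 : M.signMatrix * (M.faceMatrix * M.signMatrix *
          (M.faceMatrix * M.signMatrix)) * M.signMatrix = 1 := by
        rw [h1, mul_one, signMatrix_mul_self]
      simpa only [mul_assoc, signMatrix_mul_self, mul_one] using h4
    have h4 := congrArg Matrix.transpose h3
    simpa only [Matrix.transpose_mul, signMatrix, Matrix.diagonal_transpose,
      Matrix.transpose_one] using h4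
  rw [greedyMatrix_eq hε hE]
  simp only [Matrix.smul_mul, Matrix.mul_smul, smul_smul, hε, one_smul]
  generalize M.faceMatrix.transpose = Y at *
  generalize M.faceMatrix = Z at *
  generalize M.signMatrix = S at *
  calc Z * S * Y * S * Z * S * (Z * S * Y * S * Z * S)
      = Z * S * (Y * S) * (Z * S * (Z * S)) * (Y * S) * (Z * S) := by simp only [mul_assoc]
    _ = Z * S * (Y * S * (Y * S)) * (Z * S) := by rw [h1]; simp only [mul_assoc, mul_one]
    _ = 1 := by rw [h2, mul_one, h1]

/-- For an Eulerian sphere, the columns of `S E` all have the same sum, `1ᵀ S E = ε 1ᵀ`. -/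
theorem sum_sign_mul_greedyMatrix (hε : ε * ε = 1)
    (hE : ∀ κ : M.Simplex, ∑ ν : M.Simplex, (if κ.1 ⊆ ν.1 then (-1) ^ ν.1.card else 0) = ε)
    (ρ : M.Simplex) : ∑ σ, (M.signMatrix * M.greedyMatrix) σ ρ = ε := by
  have h1 := M.faceMatrix_mul_sign_mul_faceMatrix_mul_sign
  -- All entries of the row of the face matrix at the empty simplex are `1`.
  have hrow : ∀ A : Matrix M.Simplex M.Simplex ℚ,
      ∑ σ, A σ ρ = (M.faceMatrix * A) M.emptySimplex ρ := by
    intro A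
    rw [Matrix.mul_apply]
    exact Finset.sum_congr rfl fun σ _ => by simp [faceMatrix, emptySimplex]
  have h2 : M.faceMatrix * (M.signMatrix * M.greedyMatrix) =
      ε • (M.faceMatrix.transpose * (M.signMatrix * M.faceMatrix)) := by
    rw [greedyMatrix_eq hε hE]
    simp only [Matrix.mul_smul]
    congr 1
    calc _ = M.faceMatrix * M.signMatrix * (M.faceMatrix * M.signMatrix) *
          (M.faceMatrix.transpose * (M.signMatrix * M.faceMatrix)) := by simp only [mul_assoc]
      _ = _ := by rw [h1, one_mul]
  rw [hrow, h2, Matrix.smul_apply, Matrix.mul_apply, Finset.sum_eq_single M.emptySimplex]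
  · rw [signMatrix, Matrix.diagonal_mul]
    simp [faceMatrix, emptySimplex]
  · intro σ _ hσ
    have : ¬ σ.1 ⊆ ∅ := fun h => hσ (Subtype.ext (Finset.subset_empty.mp h))
    simp [faceMatrix, emptySimplex, Matrix.transpose_apply] at this ⊢
    exact fun h => absurd h this
  · simp

end CoxeterMatrix

namespace CoxeterSystem

variable {B : Type*} [Fintype B] {M : CoxeterMatrix B} {W : Type*} [Group W]
  (cs : CoxeterSystem M W)

open Classical in
theorem _root_.PreAbstractSimplicialComplex.sum_neg_one_pow_card
    (K : PreAbstractSimplicialComplex B) :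
    ∑ σ : Finset B with σ = ∅ ∨ σ ∈ K.faces, (-1 : ℤ) ^ σ.card = -K.reducedEulerChar := by
  have hne : ∀ σ ∈ K.faces, σ.Nonempty := fun σ hσ => (K.isRelLowerSet_faces hσ).1
  have h : (Finset.univ.filter fun σ : Finset B => σ = ∅ ∨ σ ∈ K.faces) =
      insert ∅ (Finset.univ.filter fun σ => σ ∈ K.faces) := by
    ext σ; simp
  rw [h, Finset.sum_insert (by simpa using fun h => absurd (hne _ h) (by simp)),
    PreAbstractSimplicialComplex.reducedEulerChar, neg_add, neg_neg, ← Finset.sum_neg_distrib]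
  congr 1
  refine Finset.sum_congr (by congr!) fun σ hσ => ?_
  have hpos := (hne σ (Finset.mem_filter.mp hσ).2).card_pos
  obtain ⟨m, hm⟩ : ∃ m, σ.card = m + 1 := ⟨σ.card - 1, by omega⟩
  rw [hm, Nat.add_sub_cancel, pow_succ, mul_neg_one]

open Classical in
/-- For an Eulerian sphere, the alternating sum over the cofaces of every simplex, the empty one
included, has the same value. -/
theorem sum_cofaces_eq (hM : M.IsRightAngled) {k : ℤ}
    (hN : cs.nerve.toPreAbstractSimplicialComplex.IsEulerianSphere k) (κ : M.Simplex) :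
    ∑ ν : M.Simplex, (if κ.1 ⊆ ν.1 then (-1 : ℚ) ^ ν.1.card else 0) =
      (((k + 1).negOnePow : ℤ) : ℚ) := by
  have hface : ∀ σ : Finset B, (σ = ∅ ∨ σ ∈ cs.nerve.faces) ↔ M.IsClique σ := by
    intro σ
    rw [cs.mem_nerve_faces_iff hM]
    rcases σ.eq_empty_or_nonempty with rfl | h
    · simp [CoxeterMatrix.IsClique]
    · simp [h, h.ne_empty]
  have h1 : ∑ ν : M.Simplex, (if κ.1 ⊆ ν.1 then (-1 : ℚ) ^ ν.1.card else 0) =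
      ((∑ ν : Finset B with κ.1 ⊆ ν ∧ M.IsClique ν, (-1) ^ ν.card : ℤ) : ℚ) := by
    push_cast
    rw [← CoxeterMatrix.sum_simplex_ite (M := M) (p := fun ν => κ.1 ⊆ ν ∧ M.IsClique ν)
      (fun ν hν => hν.2) (fun ν => (-1) ^ ν.card)]
    exact Finset.sum_congr rfl fun ν _ => by simp [ν.2]
  rw [h1]
  congr 1
  by_cases hκ : κ.1 = ∅
  · have h2 := cs.nerve.toPreAbstractSimplicialComplex.sum_neg_one_pow_card
    rw [hN.1] at h2
    rw [Int.negOnePow_succ, Units.val_neg, ← h2]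
    refine Finset.sum_congr (Finset.filter_congr fun σ _ => ?_) fun _ _ => rfl
    rw [hκ]
    exact (by simp : (∅ ⊆ σ ∧ M.IsClique σ) ↔ M.IsClique σ).trans (hface σ).symm
  · have hκN : κ.1 ∈ cs.nerve.faces := ((hface κ.1).mpr κ.2).resolve_left hκ
    have h2 := (cs.nerve.toPreAbstractSimplicialComplex.link κ.1).sum_neg_one_pow_card
    rw [hN.2 _ hκN] at h2
    have hlink : ∀ τ : Finset B,
        (τ = ∅ ∨ τ ∈ (cs.nerve.toPreAbstractSimplicialComplex.link κ.1).faces) ↔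
          Disjoint τ κ.1 ∧ M.IsClique (τ ∪ κ.1) := by
      intro τ
      rcases τ.eq_empty_or_nonempty with rfl | h
      · simp [κ.2]
      · have e : τ ∈ (cs.nerve.toPreAbstractSimplicialComplex.link κ.1).faces ↔
            τ.Nonempty ∧ Disjoint τ κ.1 ∧ τ ∪ κ.1 ∈ cs.nerve.faces := by
          simp only [PreAbstractSimplicialComplex.link]
          congr!
        rw [e, cs.mem_nerve_faces_iff hM]
        simp [h, h.ne_empty, h.mono Finset.subset_union_left]
    have h3 : ∑ ν : Finset B with κ.1 ⊆ ν ∧ M.IsClique ν, (-1 : ℤ) ^ ν.card =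
        (-1) ^ κ.1.card * ∑ τ : Finset B with τ = ∅ ∨
          τ ∈ (cs.nerve.toPreAbstractSimplicialComplex.link κ.1).faces, (-1) ^ τ.card := by
      rw [Finset.mul_sum]
      symm
      refine Finset.sum_bij' (fun τ _ => τ ∪ κ.1) (fun ν _ => ν \ κ.1) ?_ ?_ ?_ ?_ ?_
      · intro τ hτ
        rw [Finset.mem_filter, hlink] at hτ
        exact Finset.mem_filter.mpr
          ⟨Finset.mem_univ _, Finset.subset_union_right, hτ.2.2⟩
      · intro ν hν
        rw [Finset.mem_filter] at hν
        rw [Finset.mem_filter, hlink, Finset.sdiff_union_of_subset hν.2.1]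
        exact ⟨Finset.mem_univ _, Finset.sdiff_disjoint, hν.2.2⟩
      · intro τ hτ
        rw [Finset.mem_filter, hlink] at hτ
        exact Finset.union_sdiff_cancel_right hτ.2.1
      · intro ν hν
        rw [Finset.mem_filter] at hν
        exact Finset.sdiff_union_of_subset hν.2.1
      · intro τ hτ
        rw [Finset.mem_filter, hlink] at hτ
        rw [Finset.card_union_of_disjoint hτ.2.1, pow_add, mul_comm]
    have h4 : ((-1 : ℤ)) ^ κ.1.card = ((κ.1.card : ℤ).negOnePow : ℤ) := by
      rw [Int.negOnePow_def, zpow_natCast]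
      simp
    rw [h3, h2, h4, mul_neg, ← Units.val_mul, ← Int.negOnePow_add, Int.negOnePow_succ,
      Units.val_neg]
    congr 3
    ring

end CoxeterSystem

/-! ### The linear system of the greedy normal form -/

/-- The inverse of `1 - Q`, for `P * (1 - Q) = D - E`, in terms of the inverse `G` of `1 - D * E`,
when the inverse of `E` is its conjugate by the involution `S`. -/
theorem isInverse_of_conj_eq_inv {A : Type*} [Ring A] {P P' D E S G Q : A} (hP : P * P' = 1)
    (hP' : P' * P = 1) (hQ : P * (1 - Q) = D - E) (hS : S * S = 1) (hD : S * D = D * S)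
    (hE : E * S * (E * S) = 1) (hG : (1 - D * E) * G = 1) (hG' : G * (1 - D * E) = 1) :
    (1 - Q) * -(S * E * G * S * P) = 1 ∧ -(S * E * G * S * P) * (1 - Q) = 1 := by
  have hE' : S * E * (S * E) = 1 := by
    calc S * E * (S * E) = S * (E * S * (E * S)) * S := by simp only [mul_assoc, hS, mul_one]
      _ = 1 := by rw [hE, mul_one, hS]
  have h1 : D - E = -(S * (1 - D * E) * (S * E)) := by
    have : S * (1 - D * E) * (S * E) = S * S * E - S * D * (E * (S * E)) := by
      simp only [mul_sub, sub_mul, mul_one, mul_assoc]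
    rw [this, hS, hD, one_mul, neg_sub, mul_assoc D S, ← mul_assoc S E, hE', mul_one]
  have h2 : 1 - Q = P' * -(S * (1 - D * E) * (S * E)) := by
    rw [← h1, ← hQ, ← mul_assoc, hP', one_mul]
  rw [h2]
  constructor
  · calc _ = P' * (S * (1 - D * E) * (S * E * (S * E)) * G * S * P) := by
          simp only [mul_neg, neg_neg, neg_mul, mul_assoc]
      _ = P' * (S * ((1 - D * E) * G) * S * P) := by rw [hE', mul_one]; simp only [mul_assoc]
      _ = 1 := by rw [hG, mul_one, hS, one_mul, hP']
  · calc _ = S * E * G * S * (P * P') * S * (1 - D * E) * (S * E) := by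
          simp only [mul_neg, neg_neg, neg_mul, mul_assoc]
      _ = S * E * (G * (S * S) * (1 - D * E)) * (S * E) := by
          rw [hP, mul_one]; simp only [mul_assoc]
      _ = 1 := by rw [hS, mul_one, hG', mul_one, hE']

namespace CoxeterSystem

open NCLaurent

variable {B : Type*} {M : CoxeterMatrix B} {W : Type*} [Group W] (cs : CoxeterSystem M W)

/-- The transition matrices of an automaton for the greedy normal form: the state `σ` is left by
reading the letter `σ`, and the empty simplex is the final state. -/
noncomputable def greedyTransition [DecidableEq B] (a : cs.ProperNerve) :
    Matrix M.Simplex M.Simplex ℚ :=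
  fun σ ρ => if a.1 = σ.1 then M.greedyMatrix σ ρ else 0

variable [Fintype B] [Fintype M.Simplex]

open Classical in
theorem wordMatrix_greedyTransition (hM : M.IsRightAngled) (u : List cs.ProperNerve)
    (σ : M.Simplex) : wordMatrix cs.greedyTransition u σ M.emptySimplex =
      if cs.IsGreedy u ∧ cs.headSimplex u = σ.1 then 1 else 0 := by
  induction u generalizing σ with
  | nil =>
    rw [wordMatrix_nil, Matrix.one_apply]
    refine if_congr ?_ rfl rfl
    simp only [IsGreedy, headSimplex, true_and, Subtype.ext_iff, CoxeterMatrix.emptySimplex]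
    exact eq_comm
  | cons a u ih =>
    rw [wordMatrix_cons, Matrix.mul_apply]
    simp only [ih]
    by_cases hu : cs.IsGreedy u
    · have hclique : M.IsClique (cs.headSimplex u) := by
        cases u with
        | nil => exact M.emptySimplex.2
        | cons b u => exact ((cs.mem_nerve_faces_iff hM).mp b.2).2
      rw [Finset.sum_eq_single ⟨_, hclique⟩]
      · rw [if_pos ⟨hu, rfl⟩, mul_one, isGreedy_cons_iff cs hM]
        by_cases ha : a.1 = σ.1
        · simp [greedyTransition, CoxeterMatrix.greedyMatrix_apply, headSimplex_cons, hu, ha]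
        · simp [greedyTransition, headSimplex_cons, ha]
      · intro ρ _ hρ
        rw [if_neg fun h => hρ (Subtype.ext h.2.symm), mul_zero]
      · simp
    · rw [isGreedy_cons_iff cs hM]
      simp [hu]

open Classical in
theorem charSeries_greedyNormalForm (hM : M.IsRightAngled) :
    charSeries cs.greedyNormalForm =
      ∑ σ : M.Simplex, geomSeries cs.greedyTransition σ M.emptySimplex := by
  rw [charSeries_eq]
  ext g
  rw [NCLaurent.coeff_sum]
  by_cases hg : ∃ u, word u = g
  · obtain ⟨u, rfl⟩ := hg
    simp only [coeff_ofWords, coeff_geomSeries, cs.wordMatrix_greedyTransition hM]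
    by_cases hu : cs.IsGreedy u
    · have hclique : M.IsClique (cs.headSimplex u) := by
        cases u with
        | nil => exact M.emptySimplex.2
        | cons b u => exact ((cs.mem_nerve_faces_iff hM).mp b.2).2
      rw [if_pos (show u ∈ cs.greedyNormalForm from hu), Finset.sum_eq_single ⟨_, hclique⟩]
      · rw [if_pos ⟨hu, rfl⟩]
      · intro ρ _ hρ
        rw [if_neg fun h => hρ (Subtype.ext h.2.symm)]
      · simp
    · rw [if_neg (show u ∉ cs.greedyNormalForm from hu), Finset.sum_eq_zero]
      exact fun σ _ => if_neg fun h => hu h.1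
  · push Not at hg
    rw [coeff_ofWords_of_forall_ne _ hg, Finset.sum_eq_zero]
    exact fun σ _ => coeff_geomSeries_of_forall_ne _ _ _ hg

variable [Fintype cs.ProperNerve]

open Classical in
/-- The diagonal matrix with the entry `f σ` at a nonempty simplex `σ` and the entry `c` at the
empty simplex. -/
noncomputable def letterDiagonal (f : cs.ProperNerve → FreeGroup cs.ProperNerve)
    (c : NCLaurent cs.ProperNerve) : Matrix M.Simplex M.Simplex (NCLaurent cs.ProperNerve) :=
  Matrix.diagonal fun σ => if h : σ.1 ∈ cs.nerve.faces then mono (f ⟨σ.1, h⟩) else c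

open Classical in
theorem letterMatrix_greedyTransition
    (f : cs.ProperNerve → FreeGroup cs.ProperNerve) :
    letterMatrix f cs.greedyTransition =
      cs.letterDiagonal f 0 * M.greedyMatrix.map (algebraMap ℚ (NCLaurent cs.ProperNerve)) := by
  ext1 σ ρ
  rw [letterDiagonal, Matrix.diagonal_mul, Matrix.map_apply, letterMatrix]
  by_cases h : σ.1 ∈ cs.nerve.faces
  · rw [dif_pos h, Finset.sum_eq_single ⟨σ.1, h⟩]
    · rw [greedyTransition, if_pos rfl, Algebra.smul_def, Algebra.commutes]
    · intro a _ ha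
      rw [greedyTransition, if_neg fun h' => ha (Subtype.ext h'), zero_smul]
    · simp
  · rw [dif_neg h, zero_mul]
    refine Finset.sum_eq_zero fun a _ => ?_
    rw [greedyTransition, if_neg fun h' : a.1 = σ.1 => h (h' ▸ a.2), zero_smul]

open Classical in
theorem letterDiagonal_mul_one_sub (hM : M.IsRightAngled) :
    cs.letterDiagonal FreeGroup.of (-1) *
        (1 - letterMatrix (fun a => (FreeGroup.of a)⁻¹) cs.greedyTransition) =
      cs.letterDiagonal FreeGroup.of 0 -
        M.greedyMatrix.map (algebraMap ℚ (NCLaurent cs.ProperNerve)) := by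
  rw [cs.letterMatrix_greedyTransition]
  ext1 σ ρ
  rw [mul_sub, mul_one, ← mul_assoc]
  simp only [letterDiagonal, Matrix.diagonal_mul_diagonal, Matrix.sub_apply, Matrix.diagonal_mul]
  by_cases h : σ.1 ∈ cs.nerve.faces
  · simp only [Matrix.diagonal_apply, dif_pos h, mono_mul_mono, mul_inv_cancel, mono_one, one_mul]
  · have hσ : σ = M.emptySimplex := by
      refine Subtype.ext ?_
      by_contra hne
      exact h ((cs.mem_nerve_faces_iff hM).mpr ⟨Finset.nonempty_iff_ne_empty.mpr hne, σ.2⟩)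
    have hE : M.greedyMatrix σ ρ = if σ = ρ then 1 else 0 := by
      rw [CoxeterMatrix.greedyMatrix_apply]
      refine if_congr ?_ rfl rfl
      have hsingle : ∀ i, M.IsClique (insert i M.emptySimplex.1) := fun i => by
        simp [CoxeterMatrix.IsClique, CoxeterMatrix.emptySimplex]
      rw [hσ]
      simp only [hsingle, not_true_eq_false, imp_false, Subtype.ext_iff]
      rw [← Finset.eq_empty_iff_forall_notMem]
      exact eq_comm
    simp only [Matrix.diagonal_apply, dif_neg h, mul_zero, zero_mul, sub_zero, Matrix.map_apply, hE]
    split_ifs <;> simp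

end CoxeterSystem

theorem theoremB {B : Type*} [Fintype B] {M : CoxeterMatrix B} {W : Type*} [Group W]
    (cs : CoxeterSystem M W) (hM : M.IsRightAngled) (k : ℤ)
    (hN : cs.nerve.toPreAbstractSimplicialComplex.IsEulerianSphere k) :
    NCLaurent.IsReciprocal (NCLaurent.charSeries cs.greedyNormalForm)
      (((k + 1).negOnePow : ℤ) • NCLaurent.charSeries cs.greedyNormalForm) := by
  classical
  have : Fintype cs.ProperNerve := Fintype.ofFinite _
  have : Fintype M.Simplex := Fintype.ofFinite _
  set ε : ℚ := (((k + 1).negOnePow : ℤ) : ℚ) with hεdef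
  have hε : ε * ε = 1 := by
    rw [hεdef, ← Int.cast_mul, ← Units.val_mul, Int.units_mul_self]
    simp
  have hE : ∀ κ : M.Simplex,
      ∑ ν : M.Simplex, (if κ.1 ⊆ ν.1 then (-1) ^ ν.1.card else 0) = ε := fun κ => by
    rw [hεdef, ← cs.sum_cofaces_eq hM hN κ]
    congr!
  let φ := (algebraMap ℚ (NCLaurent cs.ProperNerve)).mapMatrix (m := M.Simplex)
  let S := φ M.signMatrix
  let E := φ M.greedyMatrix
  let P := cs.letterDiagonal FreeGroup.of (-1)
  let G := NCLaurent.geomSeries cs.greedyTransition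
  have hD : NCLaurent.letterMatrix FreeGroup.of cs.greedyTransition =
      cs.letterDiagonal FreeGroup.of 0 * E := cs.letterMatrix_greedyTransition _
  have hSdiag : S = Matrix.diagonal fun σ : M.Simplex =>
      algebraMap ℚ (NCLaurent cs.ProperNerve) ((-1) ^ σ.1.card) := by
    simp only [S, φ, CoxeterMatrix.signMatrix, RingHom.mapMatrix_apply]
    exact Matrix.diagonal_map (map_zero _)
  have hPP : ∀ f : cs.ProperNerve → FreeGroup cs.ProperNerve,
      cs.letterDiagonal f (-1) * cs.letterDiagonal (fun a => (f a)⁻¹) (-1) = 1 := by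
    intro f
    rw [CoxeterSystem.letterDiagonal, CoxeterSystem.letterDiagonal,
      Matrix.diagonal_mul_diagonal, ← Matrix.diagonal_one]
    congr 1
    funext σ
    split_ifs <;> simp [NCLaurent.mono_mul_mono, NCLaurent.mono_one]
  obtain ⟨hR, hR'⟩ := isInverse_of_conj_eq_inv (P := P)
    (P' := cs.letterDiagonal (fun a => (FreeGroup.of a)⁻¹) (-1))
    (D := cs.letterDiagonal FreeGroup.of 0) (E := E) (S := S) (G := G)
    (Q := NCLaurent.letterMatrix (fun a => (FreeGroup.of a)⁻¹) cs.greedyTransition) (hPP _)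
    (by simpa only [inv_inv] using hPP fun a => (FreeGroup.of a)⁻¹)
    (cs.letterDiagonal_mul_one_sub hM)
    (by rw [← map_mul, CoxeterMatrix.signMatrix_mul_self, map_one])
    (by
      rw [hSdiag, CoxeterSystem.letterDiagonal, Matrix.diagonal_mul_diagonal,
        Matrix.diagonal_mul_diagonal]
      congr 1
      funext σ
      exact Algebra.commutes _ _)
    (by
      rw [← map_mul, ← map_mul,
        CoxeterMatrix.greedyMatrix_mul_sign_mul_greedyMatrix_mul_sign hε hE, map_one])
    (by rw [← hD]; exact NCLaurent.one_sub_letterMatrix_mul_geomSeries _)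
    (by rw [← hD]; exact NCLaurent.geomSeries_mul_one_sub_letterMatrix _)
  have key := NCLaurent.isReciprocal_of_isInverse cs.greedyTransition (fun _ => 1)
    (fun σ => if σ = M.emptySimplex then 1 else 0) hR hR'
  have hsum : ∀ X : Matrix M.Simplex M.Simplex (NCLaurent cs.ProperNerve),
      ∑ i, ∑ j, ((1 : ℚ) * if j = M.emptySimplex then 1 else 0) • X i j =
        ∑ i, X i M.emptySimplex := by
    intro X
    simp
  rw [hsum, hsum, ← cs.charSeries_greedyNormalForm hM] at key
  -- The column of the inverse of `1 - Q̄` at the empty simplex is that of `S * E * G`.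
  have hcol : ∀ σ, (-(S * E * G * S * P)) σ M.emptySimplex = (S * E * G) σ M.emptySimplex := by
    intro σ
    have hempty : M.emptySimplex.1 ∉ cs.nerve.faces := fun h =>
      Finset.not_nonempty_empty h.1
    rw [hSdiag, Matrix.neg_apply]
    simp only [P, CoxeterSystem.letterDiagonal]
    rw [Matrix.mul_diagonal, Matrix.mul_diagonal, dif_neg hempty]
    simp [CoxeterMatrix.emptySimplex]
  have hval : ∑ σ, (-(S * E * G * S * P)) σ M.emptySimplex =
      ((k + 1).negOnePow : ℤ) • NCLaurent.charSeries cs.greedyNormalForm := by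
    simp only [hcol, Matrix.mul_apply (M := S * E)]
    rw [Finset.sum_comm, cs.charSeries_greedyNormalForm hM, Finset.smul_sum]
    refine Finset.sum_congr rfl fun τ _ => ?_
    have hrow : ∑ σ, (S * E) σ τ = algebraMap ℚ (NCLaurent cs.ProperNerve) ε := by
      rw [← CoxeterMatrix.sum_sign_mul_greedyMatrix hε hE τ, map_sum]
      refine Finset.sum_congr rfl fun σ _ => ?_
      simp only [S, E, ← map_mul]
      rfl
    rw [← Finset.sum_mul, hrow, ← Algebra.smul_def, hεdef, Int.cast_smul_eq_zsmul]
  rwa [hval] at key
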